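/- A (player-1) MDP $G=((S,E),(S_1,S_P),\delta)$ consists of a finite directed graph $(S,E)$ in which every state has at least one outgoing edge, a partition of $S$ into player-1 states $S_1$ and probabilistic states $S_P$, and a map $\delta$ from $S_P$ to probability distributions on $S$ such that for $s\in S_P$ one has $(s,t)\in E$ iff $\delta(s)(t)>0$. Assume that $G$ is bipartite, i.e. $E\subseteq (S_1\times S_P)\cup(S_P\times S_1)$, and let $r:S\to\mathbb R$ be a reward function with $r(s)>0$ for all $s$. A strategy $\sigma$ assigns to every finite sequence of states ending in a player-1 state $s$ a probability distribution on the successors of $s$; together with an initial state $s$ it determines the law $\Pr_s^\sigma$ (with expectation $\mathbb E_s^\sigma$) of the random play $\omega=\langle s_0,s_1,\dots\rangle$ with $s_0=s$. The value at $s$ of a quantitative objective $f$ is $\mathrm{Val}^G(f)(s)=\sup_\sigma \mathbb E_s^\sigma[f]$, and of an event $\Phi$ it is $\mathrm{Val}^G(\Phi)(s)=\sup_\sigma \Pr_s^\sigma(\Phi)$; put $W_1^G(\Phi)=\{s : \mathrm{Val}^G(\Phi)(s)=1\}$. For a reward function $q$ let $\limsup(q)(\omega)=\limsup_{i\to\infty}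 q(s_i)$ and $\max(q)(\omega)=\max_{i\ge 0} q(s_i)$. For a set $B$ of states let $\mathrm{Buchi}(B)$ be the set of plays in which some state of $B$ occurs infinitely often. For a set $U$ of states let $\mathrm{Attr}_P(U,G)=\bigcup_{j\ge0}T_j$, where $T_0=U$ and $T_{j+1}=T_j\cup\{s\in S_P : E(s)\cap T_j\ne\emptyset\}\cup\{s\in S_1 : E(s)\subseteq T_j\}$, with $E(s)$ the set of successors of $s$. Let $v_0>v_1>\dots>v_k$ be the elements of $r(S)$. The algorithm MDPLimSup starts with $G_0=G$, $S^0=S$, and for $i=0,\dots,k$ sets $$U_i=W_1^{G_i}\big(\mathrm{Buchi}(r^{-1}(v_i)\cap S^i)\big),\qquad S^{i+1}=S^i\setminus \mathrm{Attr}_P(U_i,G_i),$$ where $G_{i+1}$ is the sub-MDP of $G_i$ with state space $S^{i+1}$. Its output is $S^*=\bigcup_{i=0}^k (U_i\cap S_1)$ together with $f^*:S^*\to\mathbb R$, $f^*(u)=v_i$ for $u\in U_i\cap S_1$ (the sets $U_i$ are pairwise disjoint). The limsup conversion of $(G,r)$ is the MDP $\overline G$ with a reward function $\overline r$ defined as follows.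 The state space is $\overline S=S\cup\widehat S^*$, where $\widehat S^*=\{\widehat s : s\in S^*\}$ is a disjoint copy of $S^*$; the edges are those of $E$, the edges $(s,\widehat s)$ for $s\in S^*$, and the loops $(\widehat s,\widehat s)$; the player-1 states are $\overline S_1=S_1\cup\widehat S^*$; $\overline\delta=\delta$; and $\overline r(s)=0$ for $s\in S$, $\overline r(\widehat s)=f^*(s)$ for $s\in S^*$. Lemma. For every state $s\in S$, $$\mathrm{Val}^{G}(\limsup(r))(s)=\mathrm{Val}^{\overline G}(\max(\overline r))(s).$$ -/

import Mathlib

open MeasureTheory ProbabilityTheory Filter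
open scoped ENNReal

noncomputable section

/-- A (player-1) Markov decision process `((S, E), (S₁, S_P), δ)` with state space `S`: the
player-1 states are those in `S₁`, the probabilistic states `S_P` are the other ones.
Every state has an outgoing edge, and the edges out of a probabilistic state are exactly those
that have positive probability. -/
structure MDP (S : Type*) where
  /-- The edge relation. -/
  E : S → S → Prop
  /-- The set of player-1 states. -/
  S₁ : Set S
  /-- The probabilistic transition function, defined on the probabilistic states. -/
  δ : {s : S // s ∉ S₁} → PMF S
  edge_iff : ∀ (s : {s : S // s ∉ S₁}) (t : S), E s t ↔ 0 < δ s t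
  exists_edge : ∀ s, ∃ t, E s t

/-- The sum of two measurable spaces in which points are measurable is again such a space. -/
instance sumMeasurableSingletonClass {α β : Type*} [MeasurableSpace α] [MeasurableSpace β]
    [MeasurableSingletonClass α] [MeasurableSingletonClass β] :
    MeasurableSingletonClass (α ⊕ β) where
  measurableSet_singleton := by
    rintro (a | b)
    · rw [← Set.image_singleton]
      exact (measurableSet_singleton a).inl_image
    · rw [← Set.image_singleton]
      exact (measurableSet_singleton b).inr_image

namespace MDP

variable {S : Type*}

/-- Every edge goes from a player-1 state to a probabilistic state or conversely. -/
def IsBipartite (G : MDP S) : Prop :=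
  ∀ s t, G.E s t → (s ∈ G.S₁ ∧ t ∉ G.S₁) ∨ (s ∉ G.S₁ ∧ t ∈ G.S₁)

/-! ### Strategies, the law of a play, values -/

/-- A (randomized, history dependent) strategy of player 1: given the states `w` visited so far
and the current player-1 state `s`, it gives a probability distribution on the successors
of `s`. -/
structure Strategy (G : MDP S) where
  act : List S → {s : S // s ∈ G.S₁} → PMF S
  available : ∀ w s t, 0 < act w s t → G.E s t

open Classical in
/-- The distribution of the next state, if the states `w` were visited before, the current state
is `s`, and player 1 follows `σ`. -/
def next (G : MDP S) (σ : G.Strategy) (w : List S) (s : S) : PMF S :=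
  if h : s ∈ G.S₁ then σ.act w ⟨s, h⟩ else G.δ ⟨s, h⟩

/-- The transition kernel at time `n`: from the history `x₀, …, xₙ` to the state at time
`n + 1`. -/
def stepKernel [Finite S] [MeasurableSpace S] [MeasurableSingletonClass S] (G : MDP S)
    (σ : G.Strategy) (n : ℕ) : Kernel (Finset.Iic n → S) S :=
  Kernel.ofFunOfCountable fun x =>
    (G.next σ (List.ofFn fun i : Fin n => x ⟨i, Finset.mem_Iic.2 i.2.le⟩)
      (x ⟨n, Finset.mem_Iic.2 le_rfl⟩)).toMeasure

instance [Finite S] [MeasurableSpace S] [MeasurableSingletonClass S] (G : MDP S)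
    (σ : G.Strategy) (n : ℕ) : IsMarkovKernel (G.stepKernel σ n) :=
  ⟨fun _ => PMF.toMeasure.isProbabilityMeasure _⟩

/-- The law `Pr_s^σ` of the play that starts at `s` and in which player 1 follows `σ`, as a
probability measure on the space of all sequences of states (it gives measure one to the
set of plays, i.e. of the sequences that follow edges of `G`). -/
def playMeasure [Finite S] [MeasurableSpace S] [MeasurableSingletonClass S] (G : MDP S)
    (σ : G.Strategy) (s : S) : Measure (ℕ → S) :=
  Kernel.traj (X := fun _ => S) (G.stepKernel σ) 0 (fun _ => s)

/-- The value at `s` of the quantitative objective `f`: the supremum over all strategies of the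
expectation of `f`. -/
def value [Finite S] [MeasurableSpace S] [MeasurableSingletonClass S] (G : MDP S)
    (f : (ℕ → S) → ℝ) (s : S) : ℝ :=
  ⨆ σ : G.Strategy, ∫ ω, f ω ∂(G.playMeasure σ s)

/-- The value at `s` of the qualitative objective `Φ`: the supremum over all strategies of the
probability of `Φ`. -/
def prValue [Finite S] [MeasurableSpace S] [MeasurableSingletonClass S] (G : MDP S)
    (Φ : Set (ℕ → S)) (s : S) : ℝ≥0∞ :=
  ⨆ σ : G.Strategy, G.playMeasure σ s Φ

/-- The limsup objective of a reward function. -/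
def limsupObj (r : S → ℝ) (ω : ℕ → S) : ℝ := limsup (fun n => r (ω n)) atTop

/-- The max objective of a reward function (on a finite state space the supremum is attained). -/
def maxObj (r : S → ℝ) (ω : ℕ → S) : ℝ := ⨆ n, r (ω n)

/-- The set of states that occur infinitely often. -/
def infStates (ω : ℕ → S) : Set S := {s | ∃ᶠ n in atTop, ω n = s}

/-- The Büchi objective: some state of `B` is visited infinitely often. -/
def buchi (B : Set S) : Set (ℕ → S) := {ω | (infStates ω ∩ B).Nonempty}

/-- The almost-sure winning set `W₁(Φ)`: the states at which the value of `Φ` is `1`. -/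
def winSet [Finite S] [MeasurableSpace S] [MeasurableSingletonClass S] (G : MDP S)
    (Φ : Set (ℕ → S)) : Set S :=
  {s | G.prValue Φ s = 1}

/-! ### Attractors and sub-MDPs -/

/-- The sets `T₀ = U ⊆ T₁ ⊆ T₂ ⊆ …` whose union is the attractor. -/
def attrStage (G : MDP S) (U : Set S) : ℕ → Set S
  | 0 => U
  | n + 1 => attrStage G U n ∪ {s | s ∉ G.S₁ ∧ ∃ t, G.E s t ∧ t ∈ attrStage G U n} ∪
      {s | s ∈ G.S₁ ∧ ∀ t, G.E s t → t ∈ attrStage G U n}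

/-- The attractor `Attr_P(U, G)` of probabilistic states. -/
def attr (G : MDP S) (U : Set S) : Set S := ⋃ n, G.attrStage U n

/-- `X` induces a sub-MDP: all successors of probabilistic states of `X` are in `X`,
and every state of `X` has a successor in `X`. -/
def IsSub (G : MDP S) (X : Set S) : Prop :=
  (∀ s ∈ X, s ∉ G.S₁ → ∀ t, G.E s t → t ∈ X) ∧ ∀ s ∈ X, ∃ t ∈ X, G.E s t

/-- The sub-MDP of `G` with the set `X` of states. -/
def restrict (G : MDP S) (X : Set S) (hX : G.IsSub X) : MDP X where
  E s t := G.E s t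
  S₁ := {s | (s : S) ∈ G.S₁}
  δ s := (G.δ ⟨(s : X), s.2⟩).bindOnSupport fun t ht =>
    PMF.pure ⟨t, hX.1 _ s.1.2 s.2 t ((G.edge_iff ⟨(s : X), s.2⟩ t).2 (pos_iff_ne_zero.2 ht))⟩
  edge_iff s t := by
    rw [G.edge_iff ⟨(s : X), s.2⟩ t, pos_iff_ne_zero, pos_iff_ne_zero, ← PMF.mem_support_iff,
      ← PMF.mem_support_iff, PMF.mem_support_bindOnSupport_iff]
    constructor
    · intro h
      exact ⟨t, h, by simp⟩
    · rintro ⟨u, hu, h⟩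
      rw [PMF.mem_support_pure_iff] at h
      rw [h]
      exact hu
  exists_edge s := by
    obtain ⟨t, ht, h⟩ := hX.2 s s.2
    exact ⟨⟨t, ht⟩, h⟩

theorem attr_of_prob {G : MDP S} {U : Set S} {s t : S} (hs : s ∉ G.S₁) (h : G.E s t)
    (ht : t ∈ G.attr U) : s ∈ G.attr U := by
  obtain ⟨n, hn⟩ := Set.mem_iUnion.1 ht
  exact Set.mem_iUnion.2 ⟨n + 1, Or.inl (Or.inr ⟨hs, t, h, hn⟩)⟩

theorem attrStage_mono (G : MDP S) (U : Set S) : Monotone (G.attrStage U) :=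
  monotone_nat_of_le_succ fun _ _ h => Or.inl (Or.inl h)

theorem attr_of_player [Finite S] {G : MDP S} {U : Set S} {s : S} (hs : s ∈ G.S₁)
    (h : ∀ t, G.E s t → t ∈ G.attr U) : s ∈ G.attr U := by
  have h' : ∀ t, ∃ n, G.E s t → t ∈ G.attrStage U n := by
    intro t
    by_cases ht : G.E s t
    · obtain ⟨n, hn⟩ := Set.mem_iUnion.1 (h t ht)
      exact ⟨n, fun _ => hn⟩
    · exact ⟨0, fun h => absurd h ht⟩
  choose N hN using h'
  obtain ⟨M, hM⟩ := (Set.finite_range N).bddAbove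
  exact Set.mem_iUnion.2 ⟨M + 1, Or.inr ⟨hs, fun t ht =>
    G.attrStage_mono U (hM ⟨t, rfl⟩) (hN t ht)⟩⟩

/-- Removing an attractor of a sub-MDP from it leaves a sub-MDP. -/
theorem isSub_diff_attr [Finite S] (G : MDP S) (X : Set S) (hX : G.IsSub X) (U : Set X) :
    G.IsSub (X \ Subtype.val '' (G.restrict X hX).attr U) := by
  have key : ∀ s (hs : s ∈ X), s ∉ Subtype.val '' (G.restrict X hX).attr U →
      (⟨s, hs⟩ : X) ∉ (G.restrict X hX).attr U := fun s hs h h' => h ⟨_, h', rfl⟩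
  have pr : ∀ s ∈ X \ Subtype.val '' (G.restrict X hX).attr U, s ∉ G.S₁ → ∀ t, G.E s t →
      t ∈ X \ Subtype.val '' (G.restrict X hX).attr U := by
    rintro s ⟨hs, hs'⟩ hP t ht
    refine ⟨hX.1 s hs hP t ht, ?_⟩
    rintro ⟨u, hu, rfl⟩
    exact key s hs hs' (attr_of_prob (G := G.restrict X hX) (s := ⟨s, hs⟩) hP ht hu)
  refine ⟨pr, ?_⟩
  intro s hs
  by_cases hP : s ∈ G.S₁
  · by_contra hcon
    refine key s hs.1 hs.2 (attr_of_player (G := G.restrict X hX) (s := ⟨s, hs.1⟩) hP ?_)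
    intro t ht
    by_contra htn
    refine hcon ⟨t, ⟨t.2, ?_⟩, ht⟩
    rintro ⟨u, hu, hut⟩
    exact htn (Subtype.ext hut ▸ hu)
  · obtain ⟨t, ht⟩ := G.exists_edge s
    exact ⟨t, pr s hs hP t ht, ht⟩

/-! ### The algorithm MDPLimSup -/

section Algorithm

variable [Finite S]

/-- The list `v₀ > v₁ > … > v_k` of all rewards. -/
def rewardList (r : S → ℝ) : List ℝ := (Set.finite_range r).toFinset.sort (· ≥ ·)

/-- The reward `vᵢ` (only used for `i ≤ k`). -/
def reward (r : S → ℝ) (i : ℕ) : ℝ := (rewardList r).getD i 0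

variable [MeasurableSpace S] [MeasurableSingletonClass S]

/-- For the current MDP `G ↾ X` and the reward `v`, the set `W₁(Büchi(r⁻¹(v) ∩ X))`
computed in `G ↾ X`. -/
def stepWin (G : MDP S) (r : S → ℝ) (v : ℝ) (X : Set S) (hX : G.IsSub X) : Set X :=
  (G.restrict X hX).winSet (buchi {s : X | r s = v})

/-- The state space `Sⁱ` of the MDP `Gᵢ = G ↾ Sⁱ` at the start of iteration `i`: `S⁰ = S` and
`Sⁱ⁺¹ = Sⁱ \ Attr_P(Uᵢ, Gᵢ)`. -/
def stage (G : MDP S) (r : S → ℝ) : ℕ → {X : Set S // G.IsSub X}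
  | 0 => ⟨Set.univ, fun _ _ _ _ _ => trivial,
      fun s _ => (G.exists_edge s).imp fun _ h => ⟨trivial, h⟩⟩
  | i + 1 => ⟨(stage G r i).1 \ Subtype.val '' (G.restrict _ (stage G r i).2).attr
        (G.stepWin r (reward r i) _ (stage G r i).2),
      G.isSub_diff_attr _ _ _⟩

/-- The set `Uᵢ = W₁(Büchi(r⁻¹(vᵢ) ∩ Sⁱ))` computed in `Gᵢ`, as a set of states of `G`. -/
def winStage (G : MDP S) (r : S → ℝ) (i : ℕ) : Set S :=
  Subtype.val '' G.stepWin r (reward r i) _ (G.stage r i).2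

/-- The output `S*`: the union of the sets `Uᵢ ∩ S₁` for `i = 0, …, k`. -/
def sStar (G : MDP S) (r : S → ℝ) : Set S :=
  {u | ∃ i, i < (rewardList r).length ∧ u ∈ G.winStage r i ∩ G.S₁}

open Classical in
/-- The output `f*`: `f*(u) = vᵢ` for `u ∈ Uᵢ ∩ S₁` (the sets `Uᵢ` are pairwise disjoint). -/
def fStar (G : MDP S) (r : S → ℝ) (u : G.sStar r) : ℝ := reward r (Nat.find u.2)

/-! ### The limsup conversion -/

/-- The MDP `Ḡ`: each state of `S*` gets an edge to a new absorbing player-1 state, its copy. -/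
def limsupConversion (G : MDP S) (r : S → ℝ) : MDP (S ⊕ G.sStar r) where
  E
    | .inl s, .inl t => G.E s t
    | .inl s, .inr t => s = t
    | .inr _, .inl _ => False
    | .inr s, .inr t => s = t
  S₁ := Sum.inl '' G.S₁ ∪ Set.range Sum.inr
  δ
    | ⟨.inl s, hs⟩ => (G.δ ⟨s, fun h => hs (Or.inl ⟨s, h, rfl⟩)⟩).map Sum.inl
    | ⟨.inr s, hs⟩ => absurd (Or.inr ⟨s, rfl⟩) hs
  edge_iff := by
    rintro ⟨s | s, hs⟩ t
    · rw [pos_iff_ne_zero, ← PMF.mem_support_iff, PMF.mem_support_map_iff]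
      have hs' : s ∉ G.S₁ := fun h => hs (Or.inl ⟨s, h, rfl⟩)
      rcases t with t | t
      · simpa [pos_iff_ne_zero] using G.edge_iff ⟨s, hs'⟩ t
      · simp only [PMF.mem_support_iff, reduceCtorEq, and_false, exists_false, iff_false]
        rintro rfl
        exact hs' t.2.choose_spec.2.2
    · exact absurd (Or.inr ⟨s, rfl⟩) hs
  exists_edge := by
    rintro (s | s)
    · obtain ⟨t, ht⟩ := G.exists_edge s
      exact ⟨.inl t, ht⟩
    · exact ⟨.inr s, rfl⟩

/-- The reward function `r̄` of `Ḡ`: `0` on the original states, `f*(s)` on the copy of `s`. -/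
def convReward (G : MDP S) (r : S → ℝ) : S ⊕ G.sStar r → ℝ
  | .inl _ => 0
  | .inr s => G.fStar r s

end Algorithm

end MDP

end

noncomputable section

namespace MDP

section

variable {S : Type*}

/-! ### Histories and cylinders -/

/-! Each inequality comes from a superharmonic function: a function on states whose average does not
increase under any possible move. Along a play such a function is a bounded supermartingale, so it
converges almost surely, and its limit has expectation at most the initial value. An objective that
is almost surely at most this limit therefore has expectation at most the initial value under every
strategy (`IsSuperharmonic.integral_le`).

For `≤`, the function on `G` is the value of `max` in the conversion. The set `C` of states visited
infinitely often is almost surely an end component. If its largest reward is `vᵢ`, then `C` meets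
some `Uⱼ` with `j ≤ i`: otherwise no attractor would remove a state of `C` before iteration `i`, and
then the uniform strategy on `C` would put `C` inside `Uᵢ`. Bipartiteness gives a player-1 state `u`
in `C ∩ Uⱼ`. At `u` the player can move to the copy and collect `f*(u) ≥ vⱼ ≥ vᵢ`; since `u` recurs,
the limit is at least `vᵢ`, hence at least the limsup.

For `≥`, the function on the conversion is the limsup value on `S` and `f*` on the copies. It is
superharmonic because `f*` is at most the limsup value (`fStar_le_value_limsupObj`). Copies are
absorbing and original states have reward `0`, so its limit bounds the max. -/

/-- The list of the first `n` states of a sequence. -/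
def hist (ω : ℕ → S) (n : ℕ) : List S := List.ofFn fun i : Fin n => ω i

/-- The cylinder of all sequences that agree with `ω` up to time `n`. -/
def cyl (ω : ℕ → S) (n : ℕ) : Set (ℕ → S) := {η | ∀ i ≤ n, η i = ω i}

/-- The sequence `a, ω 0, ω 1, …`. -/
def consSeq (a : S) (ω : ℕ → S) : ℕ → S
  | 0 => a
  | n + 1 => ω n

theorem hist_congr {ω η : ℕ → S} {n : ℕ} (h : ∀ i < n, ω i = η i) : hist ω n = hist η n := by
  simp only [hist]
  congr 1
  funext i
  exact h i i.2

theorem hist_succ (ω : ℕ → S) (n : ℕ) :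
    hist ω (n + 1) = ω 0 :: hist (fun i => ω (i + 1)) n := by
  simp [hist, List.ofFn_succ]

theorem map_hist {T : Type*} (f : S → T) (ω : ℕ → S) (n : ℕ) :
    (hist ω n).map f = hist (f ∘ ω) n := by
  simp [hist, List.map_ofFn, Function.comp_def]

/-- After the first state is dropped, `Strategy.glue` recovers the second state in this way; the
default covers the empty remaining history, where the current state is itself the second one. -/
theorem head_hist (ω : ℕ → S) (n : ℕ) : (hist ω n).head?.getD (ω n) = ω 0 := by
  cases n with
  | zero => rfl
  | succ n => rw [hist_succ]; rfl

theorem E_of_next_pos (G : MDP S) (σ : G.Strategy) {w : List S} {s t : S}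
    (h : 0 < G.next σ w s t) : G.E s t := by
  unfold next at h
  split_ifs at h with hs
  · exact σ.available w ⟨s, hs⟩ t h
  · exact (G.edge_iff ⟨s, hs⟩ t).2 h

variable [MeasurableSpace S]

theorem measurable_consSeq (a : S) : Measurable (consSeq a) := by
  refine measurable_pi_iff.2 fun n => ?_
  cases n with
  | zero => exact measurable_const
  | succ n => exact measurable_pi_apply n

variable [MeasurableSingletonClass S]

theorem measurableSet_eval_eq (n : ℕ) (s : S) : MeasurableSet {ω : ℕ → S | ω n = s} :=
  (measurable_pi_apply (X := fun _ : ℕ => S) n) (measurableSet_singleton s)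

theorem measurableSet_cyl (ω : ℕ → S) (n : ℕ) : MeasurableSet (cyl ω n) := by
  have : cyl ω n = ⋂ i, ⋂ (_ : i ≤ n), (fun η => η i) ⁻¹' {ω i} := by ext; simp [cyl]
  rw [this]
  exact MeasurableSet.iInter fun i => MeasurableSet.iInter fun _ =>
    measurable_pi_apply i (measurableSet_singleton (ω i))

variable [Finite S]

/-- Finite measures on the space of sequences that agree on cylinders are equal. -/
theorem measure_ext_cyl {μ ν : Measure (ℕ → S)} [IsFiniteMeasure μ] [IsFiniteMeasure ν]
    (h : ∀ ω n, μ (cyl ω n) = ν (cyl ω n)) : μ = ν := by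
  rcases isEmpty_or_nonempty S with hS | ⟨⟨d⟩⟩
  · have : IsEmpty (ℕ → S) := ⟨fun f => hS.elim (f 0)⟩
    rw [μ.eq_zero_of_isEmpty, ν.eq_zero_of_isEmpty]
  have key : ∀ n, μ.map (Preorder.frestrictLe n) = ν.map (Preorder.frestrictLe n) := by
    intro n
    refine Measure.ext_of_singleton fun x => ?_
    -- A cylinder is indexed by a full sequence, so the finite history is padded with the arbitrary
    -- state `d`.
    have hx : Preorder.frestrictLe (π := fun _ => S) n ⁻¹' {x} =
        cyl (fun i => if hi : i ∈ Finset.Iic n then x ⟨i, hi⟩ else d) n := by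
      ext η
      simp only [Set.mem_preimage, Set.mem_singleton_iff, cyl, Set.mem_ofPred_eq]
      constructor
      · rintro rfl i hi
        simp [hi]
      · intro hη
        funext i
        have := hη i (Finset.mem_Iic.1 i.2)
        simpa [Finset.mem_Iic.1 i.2] using this
    rw [Measure.map_apply (by fun_prop) (measurableSet_singleton x),
      Measure.map_apply (by fun_prop) (measurableSet_singleton x), hx, h]
  refine IsProjectiveLimit.unique (α := fun _ : ℕ => S)
    (P := fun I : Finset ℕ => ν.map (I.restrict (π := fun _ : ℕ => S))) ?_ (fun I => rfl)
  intro I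
  -- Every finite set of times lies in an initial segment, so its marginal is an image of one
  -- handled by `key`.
  have hI : I ⊆ Finset.Iic (I.sup id) := fun i hi => Finset.mem_Iic.2 (Finset.le_sup (f := id) hi)
  have hr : I.restrict (π := fun _ : ℕ => S) = Finset.restrict₂ (π := fun _ : ℕ => S) hI ∘
      Preorder.frestrictLe (π := fun _ : ℕ => S) (I.sup id) := rfl
  rw [hr, ← Measure.map_map (by fun_prop) (by fun_prop), key, Measure.map_map (by fun_prop)
    (by fun_prop)]
  rfl

/-! ### The law of a play -/

instance (G : MDP S) (σ : G.Strategy) (s : S) : IsProbabilityMeasure (G.playMeasure σ s) := by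
  unfold playMeasure; infer_instance

theorem playMeasure_cyl_zero (G : MDP S) (σ : G.Strategy) (s : S) (ω : ℕ → S) (h : ω 0 = s) :
    G.playMeasure σ s (cyl ω 0) = 1 := by
  have h1 := Kernel.traj_map_frestrictLe_apply (X := fun _ => S) (κ := G.stepKernel σ) 0 0
    (fun _ => s)
  rw [Kernel.partialTraj_self] at h1
  have hc : cyl ω 0 = Preorder.frestrictLe (π := fun _ => S) 0 ⁻¹' {fun _ => s} := by
    ext η
    simp only [cyl, Set.mem_ofPred_eq, Set.mem_preimage, Set.mem_singleton_iff]
    constructor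
    · intro hη
      funext i
      have hi : (i : ℕ) = 0 := Nat.le_zero.1 (Finset.mem_Iic.1 i.2)
      rw [Preorder.frestrictLe_apply, hi, hη 0 le_rfl, h]
    · intro hη i hi
      obtain rfl : i = 0 := Nat.le_zero.1 hi
      rw [h]
      exact congrFun hη ⟨0, Finset.mem_Iic.2 le_rfl⟩
  rw [hc, ← Measure.map_apply (by fun_prop) (measurableSet_singleton _), playMeasure, h1]
  simp [Kernel.id_apply]

theorem playMeasure_ae_zero (G : MDP S) (σ : G.Strategy) (s : S) :
    ∀ᵐ ω ∂G.playMeasure σ s, ω 0 = s := by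
  have := (prob_compl_eq_zero_iff (measurableSet_cyl (fun _ => s) 0)).2
    (playMeasure_cyl_zero G σ s (fun _ => s) rfl)
  filter_upwards [compl_mem_ae_iff.2 this] with ω hω
  simp only [compl_compl, cyl, Set.mem_ofPred_eq] at hω
  exact hω 0 le_rfl

theorem playMeasure_cyl_of_ne (G : MDP S) (σ : G.Strategy) (s : S) (ω : ℕ → S) (n : ℕ)
    (h : ω 0 ≠ s) : G.playMeasure σ s (cyl ω n) = 0 := by
  refine measure_mono_null (t := {η | ¬ η 0 = s}) ?_ (playMeasure_ae_zero G σ s)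
  intro η hη h0
  exact h ((hη 0 (Nat.zero_le n)).symm.trans h0)

theorem stepKernel_frestrictLe (G : MDP S) (σ : G.Strategy) (ω : ℕ → S) (n : ℕ) :
    G.stepKernel σ n (Preorder.frestrictLe n ω) = (G.next σ (hist ω n) (ω n)).toMeasure := rfl

/-- The joint law of the history up to time `n` and the next state is the composition product of the
history's law with the step kernel; this is its value on a product of two singletons. -/
theorem playMeasure_cyl_succ (G : MDP S) (σ : G.Strategy) (s : S) (ω : ℕ → S) (n : ℕ) :
    G.playMeasure σ s (cyl ω (n + 1)) =
      G.playMeasure σ s (cyl ω n) * G.next σ (hist ω n) (ω n) (ω (n + 1)) := by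
  have h1 := Kernel.partialTraj_compProd_eq_map_traj (X := fun _ => S) (κ := G.stepKernel σ)
    (Nat.zero_le n) (x₀ := fun _ => s)
  have h2 := congrArg (fun m => m ({Preorder.frestrictLe n ω} ×ˢ {ω (n + 1)})) h1
  have hc : cyl ω n = Preorder.frestrictLe (π := fun _ => S) n ⁻¹' {Preorder.frestrictLe n ω} := by
    ext η
    simp only [cyl, Set.mem_ofPred_eq, Set.mem_preimage, Set.mem_singleton_iff]
    exact ⟨fun h => funext fun i => h i (Finset.mem_Iic.1 i.2),
      fun h i hi => congrFun h ⟨i, Finset.mem_Iic.2 hi⟩⟩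
  have hc' : cyl ω (n + 1) = (fun x : ℕ → S => (Preorder.frestrictLe (π := fun _ => S) n x,
      x (n + 1))) ⁻¹' ({Preorder.frestrictLe n ω} ×ˢ {ω (n + 1)}) := by
    ext η
    have : η ∈ cyl ω (n + 1) ↔ η ∈ cyl ω n ∧ η (n + 1) = ω (n + 1) :=
      ⟨fun h => ⟨fun i hi => h i (Nat.le_succ_of_le hi), h _ le_rfl⟩,
        fun h i hi => (Nat.le_succ_iff.1 hi).elim (h.1 i) (fun e => e ▸ h.2)⟩
    rw [this, hc]
    rfl
  rw [Measure.map_apply (by fun_prop)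
      ((measurableSet_singleton _).prod (measurableSet_singleton _)), ← hc',
    Measure.compProd_apply_prod (measurableSet_singleton _) (measurableSet_singleton _),
    Measure.restrict_singleton, lintegral_smul_measure, lintegral_dirac,
    stepKernel_frestrictLe, PMF.toMeasure_apply_singleton _ _ (measurableSet_singleton _),
    ← Kernel.traj_map_frestrictLe_apply, Measure.map_apply (by fun_prop)
      (measurableSet_singleton _), ← hc] at h2
  exact h2.symm

/-- The law of a play is characterized by its values on cylinders. -/
theorem eq_playMeasure (G : MDP S) (σ : G.Strategy) (s : S) {μ : Measure (ℕ → S)}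
    [IsProbabilityMeasure μ] (h0 : ∀ᵐ ω ∂μ, ω 0 = s)
    (h : ∀ ω n, ω 0 = s →
      μ (cyl ω (n + 1)) = μ (cyl ω n) * G.next σ (hist ω n) (ω n) (ω (n + 1))) :
    μ = G.playMeasure σ s := by
  refine measure_ext_cyl fun ω n => ?_
  by_cases hω : ω 0 = s
  · induction n with
    | zero =>
      rw [playMeasure_cyl_zero G σ s ω hω]
      refine (mem_ae_iff_prob_eq_one (measurableSet_cyl ω 0)).1 ?_
      filter_upwards [h0] with η hη i hi
      rw [Nat.le_zero.1 hi, hη, hω]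
    | succ n ih => rw [h ω n hω, ih, playMeasure_cyl_succ]
  · rw [playMeasure_cyl_of_ne G σ s ω n hω]
    refine measure_mono_null (t := {η | ¬ η 0 = s}) ?_ h0
    intro η hη h0
    exact hω ((hη 0 (Nat.zero_le n)).symm.trans h0)

theorem playMeasure_congr (G : MDP S) {σ τ : G.Strategy} {s : S}
    (h : ∀ ω n, ω 0 = s → G.next σ (hist ω n) (ω n) = G.next τ (hist ω n) (ω n)) :
    G.playMeasure σ s = G.playMeasure τ s :=
  eq_playMeasure G τ s (playMeasure_ae_zero G σ s) fun ω n hω => by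
    rw [playMeasure_cyl_succ, h ω n hω]

/-- Almost surely, all transitions have positive probability. -/
theorem ae_next_pos (G : MDP S) (σ : G.Strategy) (s : S) :
    ∀ᵐ ω ∂G.playMeasure σ s, ∀ n, 0 < G.next σ (hist ω n) (ω n) (ω (n + 1)) := by
  rw [ae_all_iff]
  intro n
  rcases isEmpty_or_nonempty S with hS | ⟨⟨d⟩⟩
  · exact hS.elim s
  let ext (x : Finset.Iic (n + 1) → S) : ℕ → S :=
    fun i => if hi : i ∈ Finset.Iic (n + 1) then x ⟨i, hi⟩ else d
  -- The exceptional set depends on finitely many coordinates, so countably many cylinders cover it,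
  -- each null by `playMeasure_cyl_succ`.
  have hcov : {ω : ℕ → S | ¬ 0 < G.next σ (hist ω n) (ω n) (ω (n + 1))} ⊆
      ⋃ x ∈ {x | ¬ 0 < G.next σ (hist (ext x) n) (ext x n) (ext x (n + 1))},
        cyl (ext x) (n + 1) := by
    intro ω hω
    have he : ∀ i ≤ n + 1, ext (fun i => ω i) i = ω i := fun i hi => by simp [ext, hi]
    refine Set.mem_biUnion (t := fun x => cyl (ext x) (n + 1)) (x := fun i => ω i) ?_
      fun i hi => (he i hi).symm
    simp only [Set.mem_ofPred_eq]
    rw [hist_congr (η := ω) fun i hi => he i (by omega), he n (by omega), he _ le_rfl]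
    exact hω
  refine measure_mono_null hcov ((measure_biUnion_null_iff (Set.to_countable _)).2 fun x hx => ?_)
  rw [playMeasure_cyl_succ, nonpos_iff_eq_zero.1 (not_lt.1 hx), mul_zero]

theorem ae_edge (G : MDP S) (σ : G.Strategy) (s : S) :
    ∀ᵐ ω ∂G.playMeasure σ s, ∀ n, G.E (ω n) (ω (n + 1)) := by
  filter_upwards [ae_next_pos G σ s] with ω hω n using E_of_next_pos G σ (hω n)

end

section

variable {S : Type*}

/-! ### Decomposition of a play after its first step -/

/-- The strategy `σ` after a first state `a`. -/
def Strategy.after {G : MDP S} (σ : G.Strategy) (a : S) : G.Strategy where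
  act w u := σ.act (a :: w) u
  available w u := σ.available (a :: w) u

/-- The strategy that moves at first as `σ` does after the history `w₀`, and that follows
`τ t` from the second state `t` on. -/
def Strategy.glue {G : MDP S} (σ : G.Strategy) (w₀ : List S) (τ : S → G.Strategy) :
    G.Strategy where
  act
    | [], u => σ.act w₀ u
    | _ :: w, u => (τ (w.head?.getD u)).act w u
  available
    | [], u => σ.available w₀ u
    | _ :: w, u => (τ (w.head?.getD u)).available w u

theorem next_after {G : MDP S} (σ : G.Strategy) (a : S) (w : List S) (u : S) :
    G.next (σ.after a) w u = G.next σ (a :: w) u := rfl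

theorem next_glue_nil {G : MDP S} (σ : G.Strategy) (w₀ : List S) (τ : S → G.Strategy) (u : S) :
    G.next (σ.glue w₀ τ) [] u = G.next σ w₀ u := rfl

theorem next_glue_cons {G : MDP S} (σ : G.Strategy) (w₀ : List S) (τ : S → G.Strategy)
    (a : S) (w : List S) (u : S) :
    G.next (σ.glue w₀ τ) (a :: w) u = G.next (τ (w.head?.getD u)) w u := rfl

variable [MeasurableSpace S] [MeasurableSingletonClass S] [Finite S]

theorem playMeasure_glue_after {G : MDP S} (σ : G.Strategy) (w₀ : List S) (τ : S → G.Strategy)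
    (s t : S) : G.playMeasure ((σ.glue w₀ τ).after s) t = G.playMeasure (τ t) t :=
  playMeasure_congr G fun ω n hω => by
    rw [next_after, next_glue_cons, head_hist, hω]

/-- The law of the play from `s` as a function of its second state. -/
def tailKernel (G : MDP S) (σ : G.Strategy) (s : S) : Kernel S (ℕ → S) :=
  Kernel.ofFunOfCountable fun t => (G.playMeasure (σ.after s) t).map (consSeq s)

instance (G : MDP S) (σ : G.Strategy) (s : S) : IsMarkovKernel (G.tailKernel σ s) :=
  ⟨fun _ => Measure.isProbabilityMeasure_map (measurable_consSeq s).aemeasurable⟩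

theorem tailKernel_apply (G : MDP S) (σ : G.Strategy) (s t : S) :
    G.tailKernel σ s t = (G.playMeasure (σ.after s) t).map (consSeq s) := rfl

theorem tailKernel_cyl_succ (G : MDP S) (σ : G.Strategy) (s t : S) (ω : ℕ → S) (n : ℕ)
    (hω : ω 0 = s) : G.tailKernel σ s t (cyl ω (n + 1)) =
      G.playMeasure (σ.after s) t (cyl (fun i => ω (i + 1)) n) := by
  rw [tailKernel_apply, Measure.map_apply (measurable_consSeq s) (measurableSet_cyl _ _)]
  congr 1
  ext η
  simp only [cyl, Set.mem_preimage, Set.mem_ofPred_eq]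
  constructor
  · exact fun h i hi => h (i + 1) (by omega)
  · intro h i hi
    cases i with
    | zero => exact hω.symm
    | succ i => exact h i (by omega)

theorem playMeasure_eq_bind (G : MDP S) (σ : G.Strategy) (s : S) :
    G.playMeasure σ s = (G.next σ [] s).toMeasure.bind (G.tailKernel σ s) := by
  have hp : IsProbabilityMeasure ((G.next σ [] s).toMeasure.bind (G.tailKernel σ s)) :=
    inferInstanceAs (IsProbabilityMeasure (G.tailKernel σ s ∘ₘ (G.next σ [] s).toMeasure))
  have hb : ∀ ω n, ((G.next σ [] s).toMeasure.bind (G.tailKernel σ s)) (cyl ω n) =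
      ∫⁻ t, G.tailKernel σ s t (cyl ω n) ∂(G.next σ [] s).toMeasure := fun ω n =>
    Measure.bind_apply (measurableSet_cyl ω n) (Kernel.aemeasurable _)
  refine (eq_playMeasure G σ s ?_ ?_).symm
  · have : ∀ t, ∀ᵐ ω ∂(G.tailKernel σ s t), ω 0 = s := by
      intro t
      rw [tailKernel_apply, ae_map_iff (measurable_consSeq s).aemeasurable
        (measurableSet_eval_eq 0 s)]
      exact Eventually.of_forall fun ω => rfl
    exact Measure.ae_comp_of_ae_ae (measurableSet_eval_eq 0 s)
      (Eventually.of_forall this)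
  · intro ω n hω
    rw [hb, hb]
    cases n with
    | zero =>
      have h1 : ∀ t, G.tailKernel σ s t (cyl ω (0 + 1)) =
          Set.indicator {ω 1} (fun _ => 1) t := by
        intro t
        rw [tailKernel_cyl_succ _ _ _ _ _ _ hω]
        by_cases ht : t = ω 1
        · rw [playMeasure_cyl_zero _ _ _ _ ht.symm, ht]
          simp
        · rw [playMeasure_cyl_of_ne _ _ _ _ _ (Ne.symm ht)]
          simp [ht]
      have h0 : ∀ t, G.tailKernel σ s t (cyl ω 0) = 1 := by
        intro t
        rw [tailKernel_apply, Measure.map_apply (measurable_consSeq s) (measurableSet_cyl _ _)]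
        convert measure_univ (μ := G.playMeasure (σ.after s) t)
        ext η
        simp only [Set.mem_preimage, Set.mem_univ, iff_true]
        intro i hi
        rw [Nat.le_zero.1 hi, hω]
        rfl
      simp only [h1, h0]
      rw [lintegral_indicator_const (measurableSet_singleton _),
        PMF.toMeasure_apply_singleton _ _ (measurableSet_singleton _), lintegral_one, measure_univ,
        hω]
      rfl
    | succ n =>
      simp only [tailKernel_cyl_succ _ _ _ _ _ _ hω]
      rw [← lintegral_mul_const _ (measurable_of_countable _)]
      congr 1
      funext t
      rw [playMeasure_cyl_succ, next_after, hist_succ ω, hω]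

theorem integral_playMeasure (G : MDP S) (σ : G.Strategy) (s : S) {f : (ℕ → S) → ℝ}
    (hf : Integrable f (G.playMeasure σ s)) :
    ∫ ω, f ω ∂G.playMeasure σ s = ∫ t, ∫ ω, f ω ∂G.tailKernel σ s t ∂(G.next σ [] s).toMeasure := by
  -- The mixture is written as a kernel composed with a constant kernel, the form in which the
  -- Fubini-type formula `Kernel.integral_comp` applies.
  have h : G.playMeasure σ s =
      (G.tailKernel σ s ∘ₖ Kernel.const Unit (G.next σ [] s).toMeasure) () := by
    rw [Kernel.comp_apply, Kernel.const_apply, playMeasure_eq_bind]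
  rw [h] at hf ⊢
  exact Kernel.integral_comp hf

theorem playMeasure_apply_eq_lintegral (G : MDP S) (σ : G.Strategy) (s : S) {Φ : Set (ℕ → S)}
    (hΦ : MeasurableSet Φ) : G.playMeasure σ s Φ =
      ∫⁻ t, G.playMeasure (σ.after s) t (consSeq s ⁻¹' Φ) ∂(G.next σ [] s).toMeasure := by
  rw [playMeasure_eq_bind, Measure.bind_apply hΦ (Kernel.aemeasurable _)]
  simp only [tailKernel_apply, Measure.map_apply (measurable_consSeq s) hΦ]

/-! ### Values -/

instance nonempty_strategy (G : MDP S) : Nonempty G.Strategy := by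
  choose t ht using G.exists_edge
  refine ⟨⟨fun _ s => PMF.pure (t s), fun _ s u hu => ?_⟩⟩
  have : u = t s := by
    by_contra h
    rw [PMF.pure_apply_of_ne _ _ h] at hu
    exact lt_irrefl _ hu
  exact this ▸ ht s

theorem integrable_playMeasure (G : MDP S) (σ : G.Strategy) (s : S) {f : (ℕ → S) → ℝ}
    (hf : Measurable f) {M : ℝ} (hM : ∀ ω, |f ω| ≤ M) : Integrable f (G.playMeasure σ s) :=
  Integrable.of_bound hf.aestronglyMeasurable M (Eventually.of_forall hM)

theorem bddAbove_integral_playMeasure (G : MDP S) (s : S) {f : (ℕ → S) → ℝ}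
    {M : ℝ} (hM : ∀ ω, |f ω| ≤ M) :
    BddAbove (Set.range fun σ : G.Strategy => ∫ ω, f ω ∂(G.playMeasure σ s)) := by
  refine ⟨M, ?_⟩
  rintro _ ⟨σ, rfl⟩
  have := norm_integral_le_of_norm_le_const (μ := G.playMeasure σ s)
    (Eventually.of_forall fun ω => (Real.norm_eq_abs (f ω)).trans_le (hM ω))
  simp only [probReal_univ, mul_one] at this
  exact (le_abs_self _).trans this

theorem integral_le_value (G : MDP S) (σ : G.Strategy) (s : S) {f : (ℕ → S) → ℝ}
    {M : ℝ} (hM : ∀ ω, |f ω| ≤ M) : ∫ ω, f ω ∂(G.playMeasure σ s) ≤ G.value f s :=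
  le_ciSup (bddAbove_integral_playMeasure G s hM) σ

/-- The values after one step, averaged, are at most the value, if adding the current state in
front of a play does not decrease the objective. -/
theorem integral_value_next_le (G : MDP S) {f : (ℕ → S) → ℝ} (hf : Measurable f)
    {M : ℝ} (hM : ∀ ω, |f ω| ≤ M) {s : S} (hs : ∀ ω, f ω ≤ f (consSeq s ω))
    (σ : G.Strategy) (w : List S) :
    ∫ t, G.value f t ∂(G.next σ w s).toMeasure ≤ G.value f s := by
  refine le_of_forall_pos_le_add fun ε hε => ?_
  -- Choose an `ε`-optimal strategy for each possible second state; gluing them behind the move `σ`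
  -- makes after `w` loses at most `ε` on average.
  have : ∀ t, ∃ τ : G.Strategy, G.value f t - ε < ∫ ω, f ω ∂(G.playMeasure τ t) := fun t =>
    exists_lt_of_lt_ciSup (sub_lt_self _ hε)
  choose τ hτ using this
  have h1 := integral_le_value G (σ.glue w τ) s hM
  rw [integral_playMeasure _ _ _ (integrable_playMeasure _ _ _ hf hM), next_glue_nil] at h1
  have h2 : ∀ t, G.value f t - ε ≤ ∫ ω, f ω ∂G.tailKernel (σ.glue w τ) s t := by
    intro t
    rw [tailKernel_apply, playMeasure_glue_after, integral_map
      (measurable_consSeq s).aemeasurable hf.aestronglyMeasurable]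
    exact (hτ t).le.trans (integral_mono (integrable_playMeasure _ _ _ hf hM)
      (integrable_playMeasure _ _ _ (hf.comp (measurable_consSeq s)) fun ω => hM _) hs)
  have h3 := integral_mono (μ := (G.next σ w s).toMeasure) .of_finite .of_finite h2
  rw [integral_sub .of_finite .of_finite, integral_const] at h3
  simp only [probReal_univ, smul_eq_mul, one_mul] at h3
  linarith

end

section

variable {S : Type*}

/-! ### Conditional expectations, superharmonic functions, fairness -/

theorem abs_le_of_finite [Finite S] (q : S → ℝ) : ∃ M, 0 ≤ M ∧ ∀ s, |q s| ≤ M := by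
  obtain ⟨M, hM⟩ := (Set.finite_range fun s => |q s|).bddAbove
  exact ⟨max M 0, le_max_right _ _, fun s => (hM ⟨s, rfl⟩).trans (le_max_left _ _)⟩

variable [MeasurableSpace S] [MeasurableSingletonClass S] [Finite S]

theorem integrable_eval (G : MDP S) (σ : G.Strategy) (s : S) (q : S → ℝ) (n : ℕ) :
    Integrable (fun ω => q (ω n)) (G.playMeasure σ s) := by
  obtain ⟨M, -, hM⟩ := abs_le_of_finite q
  exact integrable_playMeasure G σ s ((measurable_of_countable q).comp (measurable_pi_apply n))
    fun ω => hM _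

/-- Conditioning on the first `n + 1` states amounts to integrating over trajectories continued from
them, and the next coordinate of such a trajectory is distributed by the step kernel. -/
theorem condExp_eval_succ (G : MDP S) (σ : G.Strategy) (s : S) (q : S → ℝ) (n : ℕ) :
    (G.playMeasure σ s)[fun ω => q (ω (n + 1)) | Filtration.piLE (X := fun _ => S) n]
      =ᵐ[G.playMeasure σ s] fun ω => ∫ t, q t ∂(G.next σ (hist ω n) (ω n)).toMeasure := by
  have h := Kernel.condExp_traj (X := fun _ => S) (κ := G.stepKernel σ) (Nat.zero_le n)
    (x₀ := fun _ => s) (integrable_eval G σ s q (n + 1))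
  refine h.trans (Eventually.of_forall fun ω => ?_)
  simp only
  rw [← stepKernel_frestrictLe, ← Kernel.map_traj_succ_self (X := fun _ => S)
    (κ := G.stepKernel σ), Kernel.map_apply _ (by fun_prop),
    integral_map (measurable_pi_apply (X := fun _ => S) (n + 1)).aemeasurable
      (measurable_of_countable q).aestronglyMeasurable]

/-- The average of `q` after any possible next step is at most the current value of `q`. -/
def IsSuperharmonic (G : MDP S) (q : S → ℝ) : Prop :=
  ∀ (σ : G.Strategy) (w : List S) (s : S), ∫ t, q t ∂(G.next σ w s).toMeasure ≤ q s

theorem stronglyMeasurable_piLE_eval (q : S → ℝ) (n : ℕ) :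
    StronglyMeasurable[Filtration.piLE (X := fun _ => S) n] fun ω : ℕ → S => q (ω n) := by
  have h : Measurable[Filtration.piLE (X := fun _ => S) n] fun ω : ℕ → S => ω n :=
    (measurable_pi_apply (X := fun _ : Set.Iic n => S) ⟨n, Set.mem_Iic.2 le_rfl⟩).comp
      (comap_measurable _)
  exact ((measurable_of_countable q).comp h).stronglyMeasurable

theorem IsSuperharmonic.supermartingale {G : MDP S} {q : S → ℝ} (hq : G.IsSuperharmonic q)
    (σ : G.Strategy) (s : S) :
    Supermartingale (fun n (ω : ℕ → S) => q (ω n)) (Filtration.piLE (X := fun _ => S))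
      (G.playMeasure σ s) :=
  supermartingale_nat (stronglyMeasurable_piLE_eval q) (integrable_eval G σ s q) fun n => by
    filter_upwards [condExp_eval_succ G σ s q n] with ω hω
    rw [hω]
    exact hq _ _ _

/-- Doob's convergence theorem for the submartingale `-q`, which is bounded because `S` is finite.
-/
theorem IsSuperharmonic.ae_tendsto {G : MDP S} {q : S → ℝ} (hq : G.IsSuperharmonic q)
    (σ : G.Strategy) (s : S) :
    ∀ᵐ ω ∂G.playMeasure σ s, ∃ c, Tendsto (fun n => q (ω n)) atTop (nhds c) := by
  obtain ⟨M, hM0, hM⟩ := abs_le_of_finite q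
  have h := (hq.supermartingale σ s).neg.exists_ae_tendsto_of_bdd (R := M.toNNReal) (by
    intro n
    refine (eLpNorm_le_of_ae_bound (C := M) (Eventually.of_forall fun ω => ?_)).trans ?_
    · simpa using hM (ω n)
    · simp [ENNReal.ofReal])
  filter_upwards [h] with ω ⟨c, hc⟩
  exact ⟨-c, by simpa using hc.neg⟩

/-- An objective that is almost surely bounded by the limit of a superharmonic function along
the play has expectation at most the value of the function at the initial state. -/
theorem IsSuperharmonic.integral_le {G : MDP S} {q : S → ℝ} (hq : G.IsSuperharmonic q)
    (σ : G.Strategy) (s : S) {f : (ℕ → S) → ℝ} (hf : Integrable f (G.playMeasure σ s))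
    (h : ∀ᵐ ω ∂G.playMeasure σ s, ∀ c, Tendsto (fun n => q (ω n)) atTop (nhds c) → f ω ≤ c) :
    ∫ ω, f ω ∂G.playMeasure σ s ≤ q s := by
  obtain ⟨M, hM0, hM⟩ := abs_le_of_finite q
  set L : (ℕ → S) → ℝ := fun ω => limUnder atTop fun n => q (ω n)
  have hL : ∀ᵐ ω ∂G.playMeasure σ s, Tendsto (fun n => q (ω n)) atTop (nhds (L ω)) := by
    filter_upwards [hq.ae_tendsto σ s] with ω ⟨c, hc⟩
    exact tendsto_nhds_limUnder ⟨c, hc⟩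
  have hLM : ∀ᵐ ω ∂G.playMeasure σ s, ‖L ω‖ ≤ M := by
    filter_upwards [hL] with ω hω
    exact le_of_tendsto hω.norm (Eventually.of_forall fun n => hM _)
  have hLm : AEStronglyMeasurable L (G.playMeasure σ s) :=
    aestronglyMeasurable_of_tendsto_ae atTop
      (fun n => (integrable_eval G σ s q n).aestronglyMeasurable) hL
  -- Boundedness lets the estimate `hle` on the expectations at finite times pass to the limit `L`.
  have hlim := tendsto_integral_of_dominated_convergence (fun _ => M)
    (fun n => (integrable_eval G σ s q n).aestronglyMeasurable) (integrable_const M)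
    (fun n => Eventually.of_forall fun ω => hM (ω n)) hL
  have hle : ∀ n, ∫ ω, q (ω n) ∂G.playMeasure σ s ≤ q s := by
    intro n
    have h1 := (hq.supermartingale σ s).setIntegral_le (Nat.zero_le n) MeasurableSet.univ
    simp only [Measure.restrict_univ] at h1
    refine h1.trans (le_of_eq ?_)
    rw [integral_congr_ae (g := fun _ => q s)]
    · simp
    · filter_upwards [playMeasure_ae_zero G σ s] with ω hω
      rw [hω]
  calc ∫ ω, f ω ∂G.playMeasure σ s ≤ ∫ ω, L ω ∂G.playMeasure σ s := by
        refine integral_mono_ae hf (Integrable.of_bound hLm M hLM) ?_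
        filter_upwards [h, hL] with ω h1 h2 using h1 _ h2
    _ ≤ q s := le_of_tendsto hlim (Eventually.of_forall hle)

/-- If the transition from `s` to `t` always has probability at least `c > 0`, then almost surely
`t` occurs infinitely often if `s` does. -/
theorem ae_frequently_of_le (G : MDP S) (σ : G.Strategy) (s₀ : S) {s t : S} {c : ℝ≥0∞}
    (hc : 0 < c) (h : ∀ w, c ≤ G.next σ w s t) :
    ∀ᵐ ω ∂G.playMeasure σ s₀, (∃ᶠ n in atTop, ω n = s) → ∃ᶠ n in atTop, ω n = t := by
  classical
  have hc1 : c ≠ ∞ := ne_top_of_le_ne_top (PMF.apply_ne_top _ t) (h [])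
  have hpos : 0 < c.toReal := ENNReal.toReal_pos hc.ne' hc1
  -- Lévy's conditional Borel–Cantelli lemma: `t` recurs exactly when the conditional probabilities
  -- of moving to `t` have divergent sum.
  have hBC := ae_mem_limsup_atTop_iff (ℱ := Filtration.piLE (X := fun _ => S))
    (G.playMeasure σ s₀) (s := fun n => {ω : ℕ → S | ω n = t}) (by
      intro n
      have hm : Measurable[Filtration.piLE (X := fun _ => S) n] fun ω : ℕ → S => ω n :=
        (measurable_pi_apply (X := fun _ : Set.Iic n => S) ⟨n, Set.mem_Iic.2 le_rfl⟩).comp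
          (comap_measurable _)
      exact hm (measurableSet_singleton t))
  have hind : ∀ n, ({ω : ℕ → S | ω n = t}).indicator (1 : (ℕ → S) → ℝ) =
      fun ω => ({t} : Set S).indicator (fun _ => (1 : ℝ)) (ω n) := by
    intro n; funext ω; simp [Set.indicator]
  simp only [hind] at hBC
  have hce := ae_all_iff.2 fun n =>
    condExp_eval_succ G σ s₀ (({t} : Set S).indicator (fun _ => (1 : ℝ))) n
  filter_upwards [hBC, hce] with ω h1 h2 hs
  rw [mem_limsup_iff_frequently_mem] at h1
  refine h1.2 ?_
  have hval : ∀ n, ((G.playMeasure σ s₀)[fun ω => ({t} : Set S).indicator (fun _ => (1 : ℝ))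
      (ω (n + 1)) | Filtration.piLE (X := fun _ => S) n]) ω =
      (G.next σ (hist ω n) (ω n) t).toReal := by
    intro n
    rw [h2 n, integral_indicator (measurableSet_singleton t)]
    simp [Measure.real, PMF.toMeasure_apply_singleton _ _ (measurableSet_singleton t)]
  simp only [hval]
  -- Each visit to `s` contributes at least `c` to the sum, so infinitely many visits make it
  -- diverge.
  have hmono : ∀ n, c.toReal * (Nat.count (fun k => ω k = s) n : ℝ) ≤
      ∑ k ∈ Finset.range n, (G.next σ (hist ω k) (ω k) t).toReal := by
    intro n
    induction n with
    | zero => simp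
    | succ n ih =>
      rw [Finset.sum_range_succ, Nat.count_succ]
      split_ifs with hn
      · have := ENNReal.toReal_mono (PMF.apply_ne_top _ t) (h (hist ω n))
        rw [hn]
        push_cast
        linarith
      · have : 0 ≤ (G.next σ (hist ω n) (ω n) t).toReal := ENNReal.toReal_nonneg
        push_cast
        linarith
  refine tendsto_atTop_mono hmono ((tendsto_natCast_atTop_atTop.comp ?_).const_mul_atTop hpos)
  refine tendsto_atTop_atTop_of_monotone (Nat.count_monotone _) fun b => ?_
  have hinf : {k | ω k = s}.Infinite := Nat.frequently_atTop_iff_infinite.1 hs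
  exact ⟨Nat.nth (fun k => ω k = s) b, (Nat.count_nth_of_infinite hinf b).ge⟩

/-- Almost surely, every successor of a probabilistic state that occurs infinitely often occurs
infinitely often. -/
theorem ae_prob_successor_mem (G : MDP S) (σ : G.Strategy) (s₀ : S) :
    ∀ᵐ ω ∂G.playMeasure σ s₀, ∀ s t, s ∉ G.S₁ → G.E s t → s ∈ infStates ω → t ∈ infStates ω := by
  rw [ae_all_iff]; intro s
  rw [ae_all_iff]; intro t
  by_cases h : s ∉ G.S₁ ∧ G.E s t
  · have hp : ∀ w, G.δ ⟨s, h.1⟩ t ≤ G.next σ w s t := fun w => by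
      rw [next, dif_neg h.1]
    filter_upwards [ae_frequently_of_le G σ s₀ ((G.edge_iff ⟨s, h.1⟩ t).1 h.2) hp] with ω hω _ _
    exact hω
  · exact Eventually.of_forall fun ω h1 h2 => absurd ⟨h1, h2⟩ h

end

section

variable {S : Type*}

/-! ### Strategies of a sub-MDP as strategies of the MDP -/

theorem pmf_map_apply_of_injective {α β : Type*} {f : α → β} (hf : Function.Injective f)
    (p : PMF α) (a : α) : p.map f (f a) = p a := by
  rw [PMF.map_apply, tsum_eq_single a, if_pos rfl]
  intro b hb
  exact if_neg fun h => hb (hf h).symm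

open Classical in
/-- A strategy of a sub-MDP, followed in the whole MDP as long as the play stays in the
sub-MDP. -/
def Strategy.lift {G : MDP S} {X : Set S} {hX : G.IsSub X} (σ : (G.restrict X hX).Strategy)
    (τ : G.Strategy) : G.Strategy where
  act w u := if h : (u : S) ∈ X then
      (σ.act (w.filterMap fun a => if ha : a ∈ X then some ⟨a, ha⟩ else none)
        ⟨⟨u, h⟩, u.2⟩).map Subtype.val
    else τ.act w u
  available w u t ht := by
    split_ifs at ht with h
    · rw [PMF.apply_pos_iff, PMF.mem_support_map_iff] at ht
      obtain ⟨x, hx, rfl⟩ := ht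
      exact σ.available _ _ x ((PMF.apply_pos_iff _ _).2 hx)
    · exact τ.available w u t ht

theorem map_restrict_δ {G : MDP S} {X : Set S} (hX : G.IsSub X)
    (s : {s : X // s ∉ (G.restrict X hX).S₁}) :
    ((G.restrict X hX).δ s).map Subtype.val = G.δ ⟨(s : X), s.2⟩ := by
  simp only [restrict, PMF.map]
  rw [← PMF.bindOnSupport_eq_bind, PMF.bindOnSupport_bindOnSupport]
  simp

-- On histories inside `X` the filtering in `Strategy.lift` discards nothing, so the lifted strategy
-- copies the original one; at probabilistic states the two transition laws agree by
-- `map_restrict_δ`.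
open Classical in
theorem next_lift {G : MDP S} {X : Set S} {hX : G.IsSub X} (σ : (G.restrict X hX).Strategy)
    (τ : G.Strategy) (w : List X) (u : X) :
    G.next (σ.lift τ) (w.map Subtype.val) u =
      ((G.restrict X hX).next σ w u).map Subtype.val := by
  by_cases hu : (u : S) ∈ G.S₁
  · have hu' : u ∈ (G.restrict X hX).S₁ := hu
    rw [next, next, dif_pos hu, dif_pos hu']
    have hw : ((w.map Subtype.val).filterMap fun a : S =>
        if ha : a ∈ X then some (⟨a, ha⟩ : X) else none) = w := by
      rw [List.filterMap_map]
      convert List.filterMap_some (l := w) using 2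
      simp
    simp only [Strategy.lift]
    rw [dif_pos u.2, hw]
  · have hu' : u ∉ (G.restrict X hX).S₁ := hu
    rw [next, next, dif_neg hu, dif_neg hu', map_restrict_δ]

section

theorem measurable_val_comp [MeasurableSpace S] (X : Set S) :
    Measurable fun (ω : ℕ → X) (n : ℕ) => (ω n : S) :=
  measurable_pi_iff.2 fun n => measurable_subtype_coe.comp (measurable_pi_apply n)

variable [MeasurableSpace S] [MeasurableSingletonClass S] [Finite S]

/-- The law of the play under a strategy of a sub-MDP is the same in the whole MDP. -/
theorem playMeasure_lift {G : MDP S} {X : Set S} {hX : G.IsSub X}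
    (σ : (G.restrict X hX).Strategy) (τ : G.Strategy) (x : X) :
    G.playMeasure (σ.lift τ) x =
      ((G.restrict X hX).playMeasure σ x).map fun ω n => (ω n : S) := by
  classical
  have hm := measurable_val_comp X
  have hp := Measure.isProbabilityMeasure_map (μ := (G.restrict X hX).playMeasure σ x)
    hm.aemeasurable
  refine (eq_playMeasure G (σ.lift τ) x ?_ ?_).symm
  · rw [ae_map_iff hm.aemeasurable (measurableSet_eval_eq 0 _)]
    filter_upwards [playMeasure_ae_zero _ σ x] with ω hω
    rw [hω]
  · intro ω n _
    rw [Measure.map_apply hm (measurableSet_cyl _ _), Measure.map_apply hm (measurableSet_cyl _ _)]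
    -- Cylinders around sequences that leave `X` have empty preimage, so both sides of the step
    -- formula vanish once the play has left; the step that leaves has probability zero.
    have hempty : ∀ m, (∃ i ≤ m, ω i ∉ X) →
        (fun (η : ℕ → X) n => (η n : S)) ⁻¹' cyl ω m = ∅ := by
      rintro m ⟨i, hi, hiX⟩
      refine Set.eq_empty_of_forall_notMem fun η hη => hiX ?_
      rw [← hη i hi]
      exact (η i).2
    by_cases hn : ∀ i ≤ n, ω i ∈ X
    · let ω' : ℕ → X := fun i => if h : ω i ∈ X then ⟨ω i, h⟩ else x
      have hω' : ∀ i, ω i ∈ X → (ω' i : S) = ω i := fun i hi => by simp [ω', hi]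
      have hpre : ∀ m, (∀ i ≤ m, ω i ∈ X) →
          (fun (η : ℕ → X) n => (η n : S)) ⁻¹' cyl ω m = cyl ω' m := by
        intro m h
        ext η
        simp only [cyl, Set.mem_preimage, Set.mem_ofPred_eq]
        exact forall₂_congr fun i hi => by rw [← hω' i (h i hi), Subtype.ext_iff]
      have hh : hist ω n = (hist ω' n).map Subtype.val := by
        rw [map_hist]
        exact hist_congr fun i hi => (hω' i (hn i hi.le)).symm
      rw [hh, ← hω' n (hn n le_rfl), next_lift]
      by_cases hs : ω (n + 1) ∈ X
      · rw [hpre n hn, hpre (n + 1) fun i hi => (Nat.le_succ_iff.1 hi).elim (hn i) (fun e => e ▸ hs),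
          playMeasure_cyl_succ, ← hω' _ hs, pmf_map_apply_of_injective Subtype.val_injective]
      · rw [hempty (n + 1) ⟨_, le_rfl, hs⟩, measure_empty, (PMF.apply_eq_zero_iff _ _).2, mul_zero]
        rw [PMF.mem_support_map_iff]
        rintro ⟨t, -, ht⟩
        exact hs (ht ▸ t.2)
    · push Not at hn
      obtain ⟨i, hi, hiX⟩ := hn
      rw [hempty n ⟨i, hi, hiX⟩, hempty (n + 1) ⟨i, by omega, hiX⟩]
      simp

end

/-! ### The set of states that occur infinitely often -/

theorem infStates_consSeq (s : S) (ω : ℕ → S) : infStates (consSeq s ω) = infStates ω := by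
  ext t
  simp only [infStates, Set.mem_ofPred_eq]
  conv_lhs => rw [← map_add_atTop_eq_nat 1]
  rw [frequently_map]
  rfl

theorem eventually_mem_infStates [Finite S] (ω : ℕ → S) : ∀ᶠ n in atTop, ω n ∈ infStates ω := by
  have : ∀ᶠ n in atTop, ∀ s : S, s ∉ infStates ω → ω n ≠ s := by
    rw [eventually_all]
    intro s
    by_cases hs : s ∈ infStates ω
    · exact Eventually.of_forall fun n h => absurd hs h
    · filter_upwards [not_frequently.1 hs] with n hn _ using hn
  filter_upwards [this] with n hn
  by_contra h
  exact hn _ h rfl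

theorem infStates_nonempty [Finite S] (ω : ℕ → S) : (infStates ω).Nonempty :=
  let ⟨n, hn⟩ := (eventually_mem_infStates ω).exists
  ⟨ω n, hn⟩

theorem measurableSet_buchi [MeasurableSpace S] [MeasurableSingletonClass S] [Finite S]
    (B : Set S) : MeasurableSet (buchi B) := by
  have : buchi B = ⋃ s ∈ B, limsup (fun n => {ω : ℕ → S | ω n = s}) atTop := by
    ext ω
    simp only [buchi, infStates, Set.mem_ofPred_eq, Set.mem_iUnion, mem_limsup_iff_frequently_mem,
      Set.Nonempty, Set.mem_inter_iff, exists_prop]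
    exact exists_congr fun s => and_comm
  rw [this]
  exact MeasurableSet.biUnion (Set.to_countable B) fun s _ =>
    MeasurableSet.measurableSet_limsup fun n => measurableSet_eval_eq n s

/-- If the Büchi objective has value one at a probabilistic state, then it has value one at its
successors. -/
theorem mem_winSet_buchi_of_prob [MeasurableSpace S] [MeasurableSingletonClass S] [Finite S]
    {G : MDP S} {B : Set S} {s t : S} (hs : s ∉ G.S₁) (hw : s ∈ G.winSet (buchi B))
    (hE : G.E s t) : t ∈ G.winSet (buchi B) := by
  have hle : ∀ u, G.prValue (buchi B) u ≤ 1 := fun u => iSup_le fun σ => prob_le_one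
  -- The value at `s` is at most the average of the values at its successors, since a prefix does
  -- not affect the Büchi objective.
  have h1 : (1 : ℝ≥0∞) ≤ ∫⁻ u, G.prValue (buchi B) u ∂(G.δ ⟨s, hs⟩).toMeasure := by
    rw [← show G.prValue (buchi B) s = 1 from hw]
    refine iSup_le fun σ => ?_
    rw [playMeasure_apply_eq_lintegral _ _ _ (measurableSet_buchi B), next, dif_neg hs]
    refine lintegral_mono fun u => ?_
    have : consSeq s ⁻¹' buchi B = buchi B := by
      ext ω
      simp only [buchi, Set.mem_preimage, Set.mem_ofPred_eq, infStates_consSeq]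
    rw [this]
    exact le_iSup (fun σ : G.Strategy => G.playMeasure σ u (buchi B)) _
  -- A function bounded by `1` with average at least `1` equals `1` almost everywhere, hence at
  -- every successor, which has positive mass.
  have h2 : G.prValue (buchi B) =ᵐ[(G.δ ⟨s, hs⟩).toMeasure] fun _ => 1 := by
    refine ae_eq_of_ae_le_of_lintegral_le (Eventually.of_forall hle) ?_ aemeasurable_const ?_
    · exact ne_top_of_le_ne_top ENNReal.one_ne_top
        ((lintegral_mono hle).trans (by simp))
    · simpa using h1
  by_contra hcon
  have h3 : (G.δ ⟨s, hs⟩).toMeasure {t} = 0 :=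
    measure_mono_null (Set.singleton_subset_iff.2 hcon) h2
  rw [PMF.toMeasure_apply_singleton _ _ (measurableSet_singleton t)] at h3
  exact ((G.edge_iff ⟨s, hs⟩ t).1 hE).ne' h3

/-! ### End components -/

/-- A nonempty set of states that is closed under the successors of probabilistic states, in which
each state has a successor, and which is strongly connected: it has no proper nonempty subset
that no edge inside the set leaves. -/
structure IsEndComponent (G : MDP S) (C : Set S) : Prop where
  nonempty : C.Nonempty
  prob : ∀ s ∈ C, s ∉ G.S₁ → ∀ t, G.E s t → t ∈ C
  succ : ∀ s ∈ C, ∃ t ∈ C, G.E s t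
  connected : ∀ D ⊆ C, D.Nonempty → (∀ s ∈ D, ∀ t ∈ C, G.E s t → t ∈ D) → C ⊆ D

theorem IsEndComponent.restrict {G : MDP S} {C X : Set S} (hC : G.IsEndComponent C)
    (hX : G.IsSub X) (h : C ⊆ X) :
    (G.restrict X hX).IsEndComponent (Subtype.val ⁻¹' C) where
  nonempty := let ⟨s, hs⟩ := hC.nonempty; ⟨⟨s, h hs⟩, hs⟩
  prob s hs hP t ht := hC.prob s hs hP t ht
  succ s hs := let ⟨t, ht, hE⟩ := hC.succ s hs; ⟨⟨t, h ht⟩, ht, hE⟩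
  connected D hD hne hcl := by
    have := hC.connected (Subtype.val '' D) (Set.image_subset_iff.2 hD) (hne.image _) (by
      rintro _ ⟨s, hs, rfl⟩ t ht hE
      exact ⟨⟨t, h ht⟩, hcl s hs ⟨t, h ht⟩ ht hE, rfl⟩)
    intro s hs
    obtain ⟨t, ht, hts⟩ := this hs
    exact Subtype.ext hts ▸ ht

/-- An end component that meets the attractor of a set meets the set. -/
theorem IsEndComponent.inter_nonempty_of_attr {G : MDP S} {C U : Set S}
    (hC : G.IsEndComponent C) (h : (C ∩ G.attr U).Nonempty) : (C ∩ U).Nonempty := by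
  obtain ⟨s, hs, hsU⟩ := h
  obtain ⟨n, hn⟩ := Set.mem_iUnion.1 hsU
  induction n generalizing s with
  | zero => exact ⟨s, hs, hn⟩
  | succ n ih =>
    rcases hn with (hn | ⟨hP, t, hE, ht⟩) | ⟨_, hall⟩
    · exact ih s hs hsU hn
    · exact ih t (hC.prob s hs hP t hE) (Set.mem_iUnion.2 ⟨n, ht⟩) ht
    -- All successors of `s` lie in the earlier stage, and at least one of them stays in `C`.
    · obtain ⟨t, htC, hE⟩ := hC.succ s hs
      exact ih t htC (Set.mem_iUnion.2 ⟨n, hall t hE⟩) (hall t hE)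

section

variable [MeasurableSpace S] [MeasurableSingletonClass S] [Finite S]

/-- Almost surely, the states that occur infinitely often form an end component. -/
theorem ae_isEndComponent_infStates (G : MDP S) (σ : G.Strategy) (s₀ : S) :
    ∀ᵐ ω ∂G.playMeasure σ s₀, G.IsEndComponent (infStates ω) := by
  filter_upwards [ae_prob_successor_mem G σ s₀, ae_edge G σ s₀] with ω h1 h2
  obtain ⟨N, hN⟩ := eventually_atTop.1 (eventually_mem_infStates ω)
  refine ⟨infStates_nonempty ω, fun s hs hP t hE => h1 s t hP hE hs, fun s hs => ?_, ?_⟩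
  · obtain ⟨n, hn, hns⟩ := frequently_atTop.1 hs N
    exact ⟨ω (n + 1), hN _ (by omega), hns ▸ h2 n⟩
  · rintro D hD ⟨s, hs⟩ hcl
    obtain ⟨n, hn, hns⟩ := frequently_atTop.1 (hD hs) N
    -- After time `N` only recurrent states occur, so a play that enters `D` can never leave it.
    have hstay : ∀ m ≥ n, ω m ∈ D := by
      intro m hm
      induction m, hm using Nat.le_induction with
      | base => exact hns ▸ hs
      | succ m hm ih => exact hcl _ ih _ (hN _ (by omega)) (h2 m)
    intro t ht
    obtain ⟨m, hm, hmt⟩ := frequently_atTop.1 ht n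
    exact hmt ▸ hstay m hm

open Classical in
/-- The strategy that chooses uniformly among the successors in an end component. -/
def IsEndComponent.uniform {G : MDP S} {C : Set S} (hC : G.IsEndComponent C) (τ : G.Strategy) :
    G.Strategy where
  act w u := if h : (u : S) ∈ C then
      PMF.uniformOfFinset (Set.toFinite {t | t ∈ C ∧ G.E u t}).toFinset
        (let ⟨t, ht⟩ := hC.succ u h; ⟨t, (Set.Finite.mem_toFinset _).2 ht⟩)
    else τ.act w u
  available w u t ht := by
    split_ifs at ht with h
    · rw [PMF.apply_pos_iff, PMF.mem_support_uniformOfFinset_iff, Set.Finite.mem_toFinset] at ht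
      exact ht.2
    · exact τ.available w u t ht

/-- Under the uniform strategy on an end component, almost surely all its states occur
infinitely often. -/
theorem IsEndComponent.ae_subset_infStates {G : MDP S} {C : Set S} (hC : G.IsEndComponent C)
    (τ : G.Strategy) {s₀ : S} (hs₀ : s₀ ∈ C) :
    ∀ᵐ ω ∂G.playMeasure (hC.uniform τ) s₀, C ⊆ infStates ω := by
  classical
  have hstep : ∀ w, ∀ s ∈ C, ∀ t, 0 < G.next (hC.uniform τ) w s t → t ∈ C := by
    intro w s hs t ht
    by_cases hP : s ∈ G.S₁
    · rw [next, dif_pos hP] at ht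
      simp only [uniform] at ht
      rw [dif_pos hs, PMF.apply_pos_iff, PMF.mem_support_uniformOfFinset_iff,
        Set.Finite.mem_toFinset] at ht
      exact ht.1
    · exact hC.prob s hs hP t (E_of_next_pos G _ ht)
  have hfair : ∀ s ∈ G.S₁, s ∈ C → ∀ t ∈ C, G.E s t →
      ∀ᵐ ω ∂G.playMeasure (hC.uniform τ) s₀, s ∈ infStates ω → t ∈ infStates ω := by
    intro s hP hs t ht hE
    refine ae_frequently_of_le G (hC.uniform τ) s₀
      (c := ((Set.toFinite {t | t ∈ C ∧ G.E s t}).toFinset.card : ℝ≥0∞)⁻¹) (by simp) fun w => ?_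
    rw [next, dif_pos hP]
    simp only [uniform]
    rw [dif_pos hs, PMF.uniformOfFinset_apply_of_mem]
    exact (Set.Finite.mem_toFinset _).2 ⟨ht, hE⟩
  have hfair' : ∀ᵐ ω ∂G.playMeasure (hC.uniform τ) s₀, ∀ s t, s ∈ G.S₁ → s ∈ C → t ∈ C →
      G.E s t → s ∈ infStates ω → t ∈ infStates ω := by
    simp only [ae_all_iff]
    exact fun s t hP hs ht hE => hfair s hP hs t ht hE
  filter_upwards [hfair', ae_prob_successor_mem G (hC.uniform τ) s₀,
    ae_next_pos G (hC.uniform τ) s₀, playMeasure_ae_zero G (hC.uniform τ) s₀] with ω h1 h2 h3 h4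
  have hstay : ∀ n, ω n ∈ C := by
    intro n
    induction n with
    | zero => exact h4 ▸ hs₀
    | succ n ih => exact hstep _ _ ih _ (h3 n)
  -- Connectedness is applied to the recurrent set itself: it is nonempty, contained in `C`, and
  -- closed under edges inside `C` by the fairness facts.
  refine hC.connected _ ?_ (infStates_nonempty ω) ?_
  · intro s hs
    obtain ⟨n, hn⟩ := Frequently.exists hs
    exact hn ▸ hstay n
  · intro s hs t ht hE
    by_cases hP : s ∈ G.S₁
    · obtain ⟨n, hn⟩ := Frequently.exists hs
      exact h1 s t hP (hn ▸ hstay n) ht hE hs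
    · exact h2 s t hP hE hs

/-- The uniform strategy on `C` almost surely visits all of `C` infinitely often, including a state
of `B`. -/
theorem IsEndComponent.subset_winSet {G : MDP S} {C B : Set S} (hC : G.IsEndComponent C)
    (hB : (C ∩ B).Nonempty) : C ⊆ G.winSet (buchi B) := by
  intro s hs
  obtain ⟨τ⟩ := nonempty_strategy G
  refine le_antisymm (iSup_le fun σ => prob_le_one) ?_
  refine le_trans ?_ (le_iSup _ (hC.uniform τ))
  refine ((mem_ae_iff_prob_eq_one (measurableSet_buchi B)).1 ?_).ge
  filter_upwards [hC.ae_subset_infStates τ hs] with ω hω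
  obtain ⟨b, hbC, hbB⟩ := hB
  exact ⟨b, hω hbC, hbB⟩

end

end

section

variable {S : Type*}

/-! ### The objectives -/

section Objectives

theorem limsupObj_consSeq (r : S → ℝ) (s : S) (ω : ℕ → S) :
    limsupObj r (consSeq s ω) = limsupObj r ω :=
  (limsup_nat_add (fun n => r (consSeq s ω n)) 1).symm

variable [Finite S]

theorem bddAbove_range_comp {ι : Type*} (r : S → ℝ) (ω : ι → S) :
    BddAbove (Set.range fun n => r (ω n)) :=
  (Set.finite_range r).bddAbove.mono (Set.range_comp_subset_range ω r)

theorem isBoundedUnder_le_comp (r : S → ℝ) (ω : ℕ → S) :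
    IsBoundedUnder (· ≤ ·) atTop fun n => r (ω n) :=
  (bddAbove_range_comp r ω).isBoundedUnder_of_range

theorem isBoundedUnder_ge_comp (r : S → ℝ) (ω : ℕ → S) :
    IsBoundedUnder (· ≥ ·) atTop fun n => r (ω n) :=
  ((Set.finite_range r).bddBelow.mono (Set.range_comp_subset_range ω r)).isBoundedUnder_of_range

theorem limsupObj_le (r : S → ℝ) {ω : ℕ → S} {a : ℝ} (h : ∀ᶠ n in atTop, r (ω n) ≤ a) :
    limsupObj r ω ≤ a :=
  limsup_le_of_le (isBoundedUnder_ge_comp r ω).isCoboundedUnder_le h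

theorem le_limsupObj (r : S → ℝ) {ω : ℕ → S} {a : ℝ} (h : ∃ᶠ n in atTop, a ≤ r (ω n)) :
    a ≤ limsupObj r ω :=
  le_limsup_of_frequently_le h (isBoundedUnder_le_comp r ω)

theorem abs_limsupObj_le (r : S → ℝ) {M : ℝ} (hM : ∀ s, |r s| ≤ M) (ω : ℕ → S) :
    |limsupObj r ω| ≤ M :=
  abs_le.2 ⟨le_limsupObj r (Eventually.of_forall fun n => (abs_le.1 (hM (ω n))).1).frequently,
    limsupObj_le r (Eventually.of_forall fun n => (abs_le.1 (hM (ω n))).2)⟩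

theorem le_maxObj (r : S → ℝ) (ω : ℕ → S) (n : ℕ) : r (ω n) ≤ maxObj r ω :=
  le_ciSup (bddAbove_range_comp r ω) n

theorem abs_maxObj_le (r : S → ℝ) {M : ℝ} (hM : ∀ s, |r s| ≤ M) (ω : ℕ → S) :
    |maxObj r ω| ≤ M :=
  abs_le.2 ⟨(abs_le.1 (hM (ω 0))).1.trans (le_maxObj r ω 0), ciSup_le fun _ => (abs_le.1 (hM _)).2⟩

theorem maxObj_le_consSeq (r : S → ℝ) (s : S) (ω : ℕ → S) :
    maxObj r ω ≤ maxObj r (consSeq s ω) :=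
  ciSup_le fun n => le_maxObj r (consSeq s ω) (n + 1)

variable [MeasurableSpace S] [MeasurableSingletonClass S]

theorem measurable_limsupObj (r : S → ℝ) : Measurable (limsupObj r) :=
  Measurable.limsup fun n => (measurable_of_countable r).comp (measurable_pi_apply n)

theorem measurable_maxObj (r : S → ℝ) : Measurable (maxObj r) :=
  Measurable.iSup fun n => (measurable_of_countable r).comp (measurable_pi_apply n)

end Objectives

/-! ### The rewards -/

section Rewards

variable [Finite S]

theorem exists_reward_eq (r : S → ℝ) (s : S) : ∃ i < (rewardList r).length, reward r i = r s := by
  have h : r s ∈ rewardList r := by simp [rewardList]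
  obtain ⟨i, hi, he⟩ := List.getElem_of_mem h
  exact ⟨i, hi, by rw [reward, List.getD_eq_getElem _ _ hi, he]⟩

theorem reward_mem_range {r : S → ℝ} {i : ℕ} (hi : i < (rewardList r).length) :
    reward r i ∈ Set.range r := by
  have h : reward r i ∈ rewardList r := by
    rw [reward, List.getD_eq_getElem _ _ hi]
    exact List.getElem_mem hi
  simpa [rewardList] using h

theorem reward_anti {r : S → ℝ} {i j : ℕ} (hij : i ≤ j) (hj : j < (rewardList r).length) :
    reward r j ≤ reward r i := by
  rw [reward, reward, List.getD_eq_getElem _ _ hj, List.getD_eq_getElem _ _ (hij.trans_lt hj)]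
  rcases hij.eq_or_lt with rfl | h
  · exact le_rfl
  · exact List.pairwise_iff_getElem.1 (Finset.pairwise_sort _ _) i j _ hj h

end Rewards

/-! ### Superharmonicity along edges -/

section Edges

variable [MeasurableSpace S] [MeasurableSingletonClass S] [Finite S]

/-- A randomized choice only averages over successors, so at player-1 states a comparison along each
edge is enough. -/
theorem isSuperharmonic_of_edge {G : MDP S} {q : S → ℝ}
    (h₁ : ∀ s ∈ G.S₁, ∀ t, G.E s t → q t ≤ q s)
    (hP : ∀ s (hs : s ∉ G.S₁), ∫ t, q t ∂(G.δ ⟨s, hs⟩).toMeasure ≤ q s) :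
    G.IsSuperharmonic q := by
  intro σ w s
  by_cases hs : s ∈ G.S₁
  · have h : ∀ᵐ t ∂(G.next σ w s).toMeasure, q t ≤ q s := by
      rw [ae_iff, PMF.toMeasure_apply_eq_zero_iff _ (Set.to_countable _).measurableSet,
        Set.disjoint_left]
      intro t ht hn
      exact hn (h₁ s hs t (E_of_next_pos G σ ((PMF.apply_pos_iff _ _).2 ht)))
    exact (integral_mono_ae .of_finite .of_finite h).trans (by simp)
  · rw [next, dif_neg hs]
    exact hP s hs

theorem value_le_of_edge (G : MDP S) {f : (ℕ → S) → ℝ} (hf : Measurable f)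
    {M : ℝ} (hM : ∀ ω, |f ω| ≤ M) {s t : S} (hs : ∀ ω, f ω ≤ f (consSeq s ω))
    (h₁ : s ∈ G.S₁) (hE : G.E s t) : G.value f t ≤ G.value f s := by
  classical
  obtain ⟨τ⟩ := nonempty_strategy G
  -- Only the first move matters, so `σ` may move to `t` from every player-1 state that allows it.
  let σ : G.Strategy :=
    { act := fun w u => if G.E u t then PMF.pure t else τ.act w u
      available := fun w u v hv => by
        split_ifs at hv with h
        · rw [PMF.apply_pos_iff, PMF.mem_support_pure_iff] at hv
          exact hv ▸ h
        · exact τ.available w u v hv }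
  have h := integral_value_next_le G hf hM hs σ []
  have hn : G.next σ [] s = PMF.pure t := by
    rw [next, dif_pos h₁]
    exact if_pos hE
  rwa [hn, PMF.toMeasure_pure, integral_dirac] at h

theorem integral_value_δ_le (G : MDP S) {f : (ℕ → S) → ℝ} (hf : Measurable f)
    {M : ℝ} (hM : ∀ ω, |f ω| ≤ M) {s : S} (hs : ∀ ω, f ω ≤ f (consSeq s ω)) (hP : s ∉ G.S₁) :
    ∫ t, G.value f t ∂(G.δ ⟨s, hP⟩).toMeasure ≤ G.value f s := by
  obtain ⟨τ⟩ := nonempty_strategy G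
  have h := integral_value_next_le G hf hM hs τ []
  rwa [next, dif_neg hP] at h

end Edges

/-! ### The algorithm and end components -/

section

variable [MeasurableSpace S] [MeasurableSingletonClass S] [Finite S]

/-- An end component with a state of reward `vᵢ` meets some `Uⱼ` with `j ≤ i`. -/
theorem IsEndComponent.exists_winStage {G : MDP S} {C : Set S} (hC : G.IsEndComponent C)
    {r : S → ℝ} {i : ℕ} {c : S} (hc : c ∈ C) (hi : reward r i = r c) :
    ∃ j ≤ i, (C ∩ G.winStage r j).Nonempty := by
  by_contra! hcon
  -- An end component that misses `Uⱼ` also misses its attractor, so no iteration before `i` removes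
  -- a state of `C`.
  have hsub : ∀ j ≤ i, C ⊆ (G.stage r j).1 := by
    intro j hj
    induction j with
    | zero => exact fun _ _ => Set.mem_univ _
    | succ j ih =>
      have hCj := ih (by omega)
      refine fun s hs => ⟨hCj hs, ?_⟩
      rintro ⟨x, hx, rfl⟩
      obtain ⟨y, hyC, hy⟩ :=
        (hC.restrict (G.stage r j).2 hCj).inter_nonempty_of_attr ⟨x, hs, hx⟩
      exact (hcon j (by omega)).subset ⟨hyC, y, hy, rfl⟩
  have hCi := hsub i le_rfl
  have := (hC.restrict (G.stage r i).2 hCi).subset_winSet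
    (B := {s : (G.stage r i).1 | r s = reward r i})
    ⟨⟨c, hCi hc⟩, hc, hi.symm⟩
  exact (hcon i le_rfl).subset ⟨hc, ⟨c, hCi hc⟩, this hc, rfl⟩

/-- From a probabilistic state of `Uⱼ`, any successor is again in `Uⱼ` and is a player-1 state by
bipartiteness; one of them lies in `C`. -/
theorem IsEndComponent.exists_winStage_player {G : MDP S} (hG : G.IsBipartite) {C : Set S}
    (hC : G.IsEndComponent C) {r : S → ℝ} {j : ℕ} (h : (C ∩ G.winStage r j).Nonempty) :
    ∃ u ∈ C, u ∈ G.winStage r j ∩ G.S₁ := by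
  obtain ⟨_, hs, x, hx, rfl⟩ := h
  by_cases hP : (x : S) ∈ G.S₁
  · exact ⟨x, hs, ⟨x, hx, rfl⟩, hP⟩
  · obtain ⟨t, ht, hE⟩ := hC.succ x hs
    have htX : t ∈ (G.stage r j).1 := (G.stage r j).2.1 x x.2 hP t hE
    refine ⟨t, ht, ⟨⟨t, htX⟩, ?_, rfl⟩, ?_⟩
    · exact mem_winSet_buchi_of_prob (G := G.restrict _ (G.stage r j).2) (t := ⟨t, htX⟩) hP hx hE
    · rcases hG _ _ hE with h | h
      · exact absurd h.1 hP
      · exact h.2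

/-- A strategy of `Gᵢ` lifted to `G` earns limsup at least `vᵢ` on the Büchi event and at least `0`
elsewhere, because rewards are positive. The bound on the Büchi probability passes to the supremum,
so no strategy attaining probability one is needed. -/
theorem le_value_limsupObj_of_winStage {G : MDP S} {r : S → ℝ} (hr : ∀ s, 0 < r s) {i : ℕ}
    (hi : i < (rewardList r).length) {u : S} (hu : u ∈ G.winStage r i) :
    reward r i ≤ G.value (limsupObj r) u := by
  obtain ⟨x, hx, rfl⟩ := hu
  obtain ⟨M, hM0, hM⟩ := abs_le_of_finite r
  obtain ⟨τ⟩ := nonempty_strategy G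
  have hv : 0 < reward r i := by
    obtain ⟨s, hs⟩ := reward_mem_range hi
    exact hs ▸ hr s
  set B : Set (G.stage r i).1 := {s | r s = reward r i}
  have key : ∀ σ : (G.restrict _ (G.stage r i).2).Strategy,
      (G.restrict _ (G.stage r i).2).playMeasure σ x (buchi B) ≤
        ENNReal.ofReal (G.value (limsupObj r) x / reward r i) := by
    intro σ
    set μ := (G.restrict _ (G.stage r i).2).playMeasure σ x
    have h1 := integral_le_value G (σ.lift τ) x (abs_limsupObj_le r hM)
    rw [playMeasure_lift, integral_map (measurable_val_comp _).aemeasurable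
      (measurable_limsupObj r).aestronglyMeasurable] at h1
    have h2 : ∫ ω, (buchi B).indicator (fun _ => reward r i) ω ∂μ ≤
        ∫ ω, limsupObj r (fun n => (ω n : S)) ∂μ := by
      refine integral_mono ((integrable_const _).indicator (measurableSet_buchi B))
        (integrable_playMeasure _ σ x
          ((measurable_limsupObj r).comp (measurable_val_comp _))
          fun ω => abs_limsupObj_le r hM _) fun ω => ?_
      by_cases hω : ω ∈ buchi B
      · rw [Set.indicator_of_mem hω]
        obtain ⟨b, hb, hbB⟩ := hω
        exact le_limsupObj r (Frequently.mono hb fun n hn => by rw [hn]; exact (Eq.ge hbB))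
      · rw [Set.indicator_of_notMem hω]
        exact le_limsupObj r (Eventually.of_forall fun n => (hr _).le).frequently
    rw [integral_indicator_const _ (measurableSet_buchi B), smul_eq_mul] at h2
    rw [← ofReal_measureReal]
    exact ENNReal.ofReal_le_ofReal ((le_div_iff₀ hv).2 (h2.trans h1))
  have h1 : (1 : ℝ≥0∞) ≤ ENNReal.ofReal (G.value (limsupObj r) x / reward r i) := by
    rw [← show (G.restrict _ (G.stage r i).2).prValue (buchi B) x = 1 from hx]
    exact iSup_le key
  rw [ENNReal.one_le_ofReal, one_le_div hv] at h1
  exact h1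

/-! ### The two inequalities -/

theorem fStar_pos {G : MDP S} {r : S → ℝ} (hr : ∀ s, 0 < r s) (u : G.sStar r) :
    0 < G.fStar r u := by
  classical
  obtain ⟨s, hs⟩ := reward_mem_range (Nat.find_spec u.2).1
  rw [fStar, ← hs]
  exact hr s

theorem fStar_le_value_limsupObj {G : MDP S} {r : S → ℝ} (hr : ∀ s, 0 < r s) (u : G.sStar r) :
    G.fStar r u ≤ G.value (limsupObj r) u := by
  classical
  exact le_value_limsupObj_of_winStage hr (Nat.find_spec u.2).1 (Nat.find_spec u.2).2.1

/-- `fStar` uses the least admissible index and the rewards decrease, so disjointness of the sets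
`Uᵢ` plays no role. -/
theorem le_fStar {G : MDP S} {r : S → ℝ} {j : ℕ} (hj : j < (rewardList r).length) {u : S}
    (hu : u ∈ G.winStage r j ∩ G.S₁) : reward r j ≤ G.fStar r ⟨u, j, hj, hu⟩ := by
  classical
  exact reward_anti (Nat.find_min' _ ⟨hj, hu⟩) hj

theorem mem_limsupConversion_inl {G : MDP S} {r : S → ℝ} {s : S} :
    Sum.inl s ∈ (G.limsupConversion r).S₁ ↔ s ∈ G.S₁ := by
  simp [limsupConversion]

theorem integral_limsupConversion_δ {G : MDP S} {r : S → ℝ} {s : S} (hs : s ∉ G.S₁)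
    (q : S ⊕ G.sStar r → ℝ) :
    ∫ t, q t ∂((G.limsupConversion r).δ
      ⟨Sum.inl s, fun h => hs (mem_limsupConversion_inl.1 h)⟩).toMeasure =
      ∫ t, q (Sum.inl t) ∂(G.δ ⟨s, hs⟩).toMeasure := by
  have h : ((G.limsupConversion r).δ
      ⟨Sum.inl s, fun h => hs (mem_limsupConversion_inl.1 h)⟩).toMeasure =
      (G.δ ⟨s, hs⟩).toMeasure.map Sum.inl := by
    rw [PMF.toMeasure_map _ _ measurable_inl]
    rfl
  rw [h, integral_map measurable_inl.aemeasurable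
    (measurable_of_countable q).aestronglyMeasurable]

theorem value_limsupObj_le {G : MDP S} (hG : G.IsBipartite) (r : S → ℝ) (s : S) :
    G.value (limsupObj r) s ≤
      (G.limsupConversion r).value (maxObj (G.convReward r)) (Sum.inl s) := by
  obtain ⟨M, -, hM⟩ := abs_le_of_finite r
  obtain ⟨N, -, hN⟩ := abs_le_of_finite (G.convReward r)
  set f := maxObj (G.convReward r)
  have hf : Measurable f := measurable_maxObj _
  have hfN : ∀ ω, |f ω| ≤ N := abs_maxObj_le _ hN
  have hcons : ∀ s ω, f ω ≤ f (consSeq s ω) := maxObj_le_consSeq _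
  set h : S → ℝ := fun t => (G.limsupConversion r).value f (Sum.inl t)
  have hsuper : G.IsSuperharmonic h := by
    refine isSuperharmonic_of_edge (fun s hs t hE => ?_) fun s hs => ?_
    · exact value_le_of_edge _ hf hfN (hcons _) (mem_limsupConversion_inl.2 hs)
        (show (G.limsupConversion r).E (Sum.inl s) (Sum.inl t) from hE)
    · have := integral_value_δ_le (G.limsupConversion r) hf hfN (hcons (Sum.inl s))
        fun h => hs (mem_limsupConversion_inl.1 h)
      rwa [integral_limsupConversion_δ hs] at this
  -- From `u` the player can step to the copy of `u`, whose reward is already collected at time `0`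
  -- of the continuation.
  have hstar : ∀ u : G.sStar r, G.fStar r u ≤ h u := by
    intro u
    obtain ⟨τ⟩ := nonempty_strategy (G.limsupConversion r)
    have h1 : (G.limsupConversion r).value f (Sum.inr u) ≤ h u :=
      value_le_of_edge _ hf hfN (hcons _)
        (mem_limsupConversion_inl.2 u.2.choose_spec.2.2)
        (show (G.limsupConversion r).E (Sum.inl (u : S)) (Sum.inr u) from rfl)
    refine le_trans ?_ ((integral_le_value _ τ (Sum.inr u) hfN).trans h1)
    have h2 := integral_mono_ae (μ := (G.limsupConversion r).playMeasure τ (Sum.inr u))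
      (integrable_const (G.fStar r u)) (integrable_playMeasure _ τ _ hf hfN) (by
        filter_upwards [playMeasure_ae_zero _ τ (Sum.inr u)] with ω hω
        have := le_maxObj (G.convReward r) ω 0
        rw [hω] at this
        exact this)
    simpa using h2
  have := nonempty_strategy G
  refine ciSup_le fun σ => hsuper.integral_le σ s
    (integrable_playMeasure _ _ _ (measurable_limsupObj r) (abs_limsupObj_le r hM)) ?_
  filter_upwards [ae_isEndComponent_infStates G σ s] with ω hC c hlim
  obtain ⟨b, hb, hmax⟩ := Set.exists_max_image (infStates ω) r (Set.toFinite _) hC.nonempty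
  obtain ⟨i, hi, hib⟩ := exists_reward_eq r b
  obtain ⟨j, hj, hne⟩ := hC.exists_winStage hb hib
  obtain ⟨u, hu, hUu⟩ := hC.exists_winStage_player hG hne
  have hjl := hj.trans_lt hi
  calc limsupObj r ω ≤ r b :=
        limsupObj_le r ((eventually_mem_infStates ω).mono fun n hn => hmax _ hn)
    _ = reward r i := hib.symm
    _ ≤ reward r j := reward_anti hj hi
    _ ≤ h u := (le_fStar hjl hUu).trans (hstar _)
    _ ≤ c := by
        -- The state `u` recurs, so the value `h u` is taken infinitely often and the limit `c`
        -- cannot be smaller.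
        have : ∃ᶠ n in atTop, h u ≤ h (ω n) := Frequently.mono hu fun n hn => by rw [hn]
        exact ge_of_tendsto_of_frequently hlim this

theorem value_maxObj_le {G : MDP S} {r : S → ℝ} (hr : ∀ s, 0 < r s) (s : S) :
    (G.limsupConversion r).value (maxObj (G.convReward r)) (Sum.inl s) ≤
      G.value (limsupObj r) s := by
  obtain ⟨M, -, hM⟩ := abs_le_of_finite r
  obtain ⟨N, -, hN⟩ := abs_le_of_finite (G.convReward r)
  have hf := measurable_limsupObj r
  have hfM := abs_limsupObj_le r hM
  have hcons : ∀ s ω, limsupObj r ω ≤ limsupObj r (consSeq s ω) := fun s ω =>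
    (limsupObj_consSeq r s ω).ge
  set q : S ⊕ G.sStar r → ℝ := Sum.elim (G.value (limsupObj r)) (G.fStar r)
  -- Nonnegativity makes the limit of `q` dominate the reward `0` of the original states.
  have hq0 : ∀ x, 0 ≤ q x := by
    rintro (t | u)
    · obtain ⟨τ⟩ := nonempty_strategy G
      exact (integral_nonneg fun ω => le_limsupObj r
        (Eventually.of_forall fun n => (hr _).le).frequently).trans (integral_le_value G τ t hfM)
    · exact (fStar_pos hr u).le
  have hsuper : (G.limsupConversion r).IsSuperharmonic q := by
    refine isSuperharmonic_of_edge ?_ ?_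
    · rintro (t | u) hs (t' | u') hE
      · exact value_le_of_edge G hf hfM (hcons t) (mem_limsupConversion_inl.1 hs) hE
      · obtain rfl : t = u' := hE
        exact fStar_le_value_limsupObj hr u'
      · exact hE.elim
      · obtain rfl : u = u' := Subtype.ext (congrArg Subtype.val hE)
        exact le_rfl
    · rintro (t | u) hs
      · have ht : t ∉ G.S₁ := fun h => hs (mem_limsupConversion_inl.2 h)
        exact (integral_limsupConversion_δ ht q).trans_le
          (integral_value_δ_le G hf hfM (hcons t) ht)
      · exact absurd (Or.inr ⟨u, rfl⟩) hs
  have := nonempty_strategy (G.limsupConversion r)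
  refine ciSup_le fun σ => hsuper.integral_le σ (Sum.inl s)
    (integrable_playMeasure _ _ _ (measurable_maxObj _) (abs_maxObj_le _ hN)) ?_
  filter_upwards [ae_edge _ σ (Sum.inl s)] with ω hE c hlim
  refine ciSup_le fun n => ?_
  rcases hn : ω n with t | u
  · exact ge_of_tendsto hlim (Eventually.of_forall fun n => hq0 _)
  -- Copies are absorbing: once the play reaches the copy of `u`, `q` is constantly `f*(u)`, the
  -- reward collected there.
  · have hstay : ∀ m ≥ n, ω m = Sum.inr u := by
      intro m hm
      induction m, hm using Nat.le_induction with
      | base => exact hn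
      | succ m hm ih =>
        have hEm := hE m
        rw [ih] at hEm
        rcases hm' : ω (m + 1) with t | u'
        · rw [hm'] at hEm
          exact hEm.elim
        · rw [hm'] at hEm
          exact congrArg Sum.inr (show u = u' from hEm).symm
    refine ge_of_tendsto hlim (eventually_atTop.2 ⟨n, fun m hm => ?_⟩)
    rw [hstay m hm]
    exact le_rfl

end

end

end MDP

end

theorem mainTheorem4 {S : Type*} [Finite S] [MeasurableSpace S] [MeasurableSingletonClass S]
    (G : MDP S) (hG : G.IsBipartite) (r : S → ℝ) (hr : ∀ s, 0 < r s) (s : S) :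
    G.value (MDP.limsupObj r) s =
      (G.limsupConversion r).value (MDP.maxObj (G.convReward r)) (Sum.inl s) :=
  le_antisymm (MDP.value_limsupObj_le hG r s) (MDP.value_maxObj_le hr s)
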